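/- Let $\mathcal O$ be a complete discrete valuation ring with uniformizer $\epsilon$, let $n$ and $i$ be integers with $2\le i\le n-2$, and let $A=\mathcal O[X]/(X^n)$. An $A$-lattice is an $A$-module which is free of finite rank over $\mathcal O$; it is indecomposable if it is nonzero and is not the direct sum of two nonzero submodules. For $A$-lattices $M,N$, $\operatorname{Rad}\operatorname{Hom}_A(M,N)$ is the set of $f\in\operatorname{Hom}_A(M,N)$ such that $hfg$ lies in the Jacobson radical of $\operatorname{End}_A(Y)$ for every indecomposable $A$-lattice $Y$ and all $g\in\operatorname{Hom}_A(Y,M)$, $h\in\operatorname{Hom}_A(N,Y)$. A short exact sequence of $A$-lattices $0\to L\to F\xrightarrow{p}M\to 0$ is an almost split sequence ending at $M$ if $p$ does not split, $L$ and $M$ are indecomposable, and for every indecomposable $A$-lattice $Y$ the image of $\operatorname{Hom}_A(Y,p):\operatorname{Hom}_A(Y,F)\to\operatorname{Hom}_A(Y,M)$ is $\operatorname{Rad}\operatorname{Hom}_A(Y,M)$. For $0<j<n$ let $Z_j\subseteq A$ be the kernel of $A\to A/\epsilon A$, $f\mapsto X^jf+\epsilon A$ (the Heller lattice of $(X^jA+\epsilon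 A)/\epsilon A$), i.e. $$Z_j=\mathcal O\epsilon\oplus\mathcal O\epsilon X\oplus\cdots\oplus\mathcal O\epsilon X^{n-j-1}\oplus\mathcal O X^{n-j}\oplus\cdots\oplus\mathcal O X^{n-1},$$ let $\phi:Z_j\to Z_j$ be the $A$-linear map with $\phi(\epsilon)=X^{n-1}$ which sends all the other elements of this basis to $0$ (so $\epsilon\,\phi(h)=X^{n-1}h$), let $\pi:A\oplus A\to Z_j$ be $\pi(f,g)=X^{n-j}f-\epsilon g$, and put $$E_j=\{(f,g,h)\in A\oplus A\oplus Z_j\mid \pi(f,g)=\phi(h)\}.$$ Then there is an almost split sequence $0\to E_{n-i}\to F_i\to E_i\to 0$ of $A$-lattices ending at $E_i$. Moreover, for every almost split sequence of $A$-lattices $0\to L\to F\to E_i\to 0$ ending at $E_i$, one has $L\simeq E_{n-i}$, and $F$ is the direct sum of a submodule isomorphic to $Z_{n-i}$ and an indecomposable submodule. -/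

import Mathlib

open Polynomial

universe u

/-! ### Lattices over an order and almost split sequences -/

section Orders

variable (O : Type u) (A : Type u) [CommRing O] [Ring A] [Algebra O A]

/-- `M` is an `A`-lattice: an `A`-module that is free of finite rank over `O`. -/
structure IsALattice (M : Type u) [AddCommGroup M] [Module O M] [Module A M]
    [IsScalarTower O A M] : Prop where
  finite : Module.Finite O M
  free : Module.Free O M

/-- `M` is an indecomposable `A`-module: it is nonzero and it is not the (internal) direct sum of
two nonzero submodules. -/
structure IsIndecomposableModule (M : Type u) [AddCommGroup M] [Module A M] : Prop where
  nontrivial : Nontrivial M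
  eq_bot_or_eq_bot : ∀ P Q : Submodule A M, IsCompl P Q → P = ⊥ ∨ Q = ⊥

/-- `f` belongs to `Rad Hom_A(M, N)`: for every indecomposable `A`-lattice `Y` and all
`g : Y → M` and `h : N → Y`, the composite `h f g` lies in the Jacobson radical of `End_A(Y)`. -/
def IsRadicalHom {M N : Type u} [AddCommGroup M] [Module A M] [AddCommGroup N] [Module A N]
    (f : M →ₗ[A] N) : Prop :=
  ∀ (Y : Type u) [AddCommGroup Y] [Module O Y] [Module A Y] [IsScalarTower O A Y],
    IsALattice O A Y → IsIndecomposableModule A Y →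
    ∀ (g : Y →ₗ[A] M) (h : N →ₗ[A] Y), h ∘ₗ f ∘ₗ g ∈ Ring.jacobson (Module.End A Y)

/-- `0 → L → E → M → 0`, with maps `ι` and `p`, is an almost split sequence of `A`-lattices
ending at `M`. -/
structure IsAlmostSplitSequence {L E M : Type u}
    [AddCommGroup L] [Module O L] [Module A L] [IsScalarTower O A L]
    [AddCommGroup E] [Module O E] [Module A E] [IsScalarTower O A E]
    [AddCommGroup M] [Module O M] [Module A M] [IsScalarTower O A M]
    (ι : L →ₗ[A] E) (p : E →ₗ[A] M) : Prop where
  lattice_left : IsALattice O A L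
  lattice_middle : IsALattice O A E
  lattice_right : IsALattice O A M
  injective : Function.Injective ι
  exact : Function.Exact ι p
  surjective : Function.Surjective p
  not_split : ¬ ∃ s : M →ₗ[A] E, p ∘ₗ s = LinearMap.id
  indecomposable_left : IsIndecomposableModule A L
  indecomposable_right : IsIndecomposableModule A M
  /-- `Hom_A(X, p)` has image exactly `Rad Hom_A(X, M)`, for every indecomposable lattice `X`. -/
  factor_iff : ∀ (X : Type u) [AddCommGroup X] [Module O X] [Module A X] [IsScalarTower O A X],
    IsALattice O A X → IsIndecomposableModule A X →
    ∀ f : X →ₗ[A] M, IsRadicalHom O A f ↔ ∃ g : X →ₗ[A] E, p ∘ₗ g = f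

end Orders

/-! ### The truncated polynomial ring, its Heller lattices, and the lattices `E_i` -/

/-- The truncated polynomial ring `O[X]/(X^n)`. -/
abbrev TruncPoly (O : Type u) [CommRing O] (n : ℕ) : Type u := AdjoinRoot (X ^ n : O[X])

namespace TruncPoly

section

variable {O : Type u} [CommRing O] (ε : O) (n : ℕ)

/-- The class of the variable `X` in `O[X]/(X^n)`. -/
noncomputable abbrev x (O : Type u) [CommRing O] (n : ℕ) : TruncPoly O n :=
  AdjoinRoot.root (X ^ n : O[X])

/-- The element `ε` of `O`, viewed in `O[X]/(X^n)`. -/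
noncomputable abbrev eps : TruncPoly O n := algebraMap O (TruncPoly O n) ε

/-- The map `A → A/εA`, `f ↦ X^i f + εA`. Its image is `M_i = (X^i A + εA)/εA ≅ κ[X]/(X^{n-i})`,
and for `0 < i < n` it is the projective cover of `M_i`. -/
noncomputable def coverMap (i : ℕ) :
    TruncPoly O n →ₗ[TruncPoly O n] TruncPoly O n ⧸ Ideal.span {eps ε n} :=
  (Ideal.span {eps ε n}).mkQ ∘ₗ LinearMap.mulLeft (TruncPoly O n) (x O n ^ i)

/-- The Heller lattice `Z_i` of `M_i`: the kernel of the projective cover `A → M_i`. -/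
noncomputable def heller (i : ℕ) : Submodule (TruncPoly O n) (TruncPoly O n) :=
  LinearMap.ker (coverMap ε n i)

theorem mem_heller {i : ℕ} {f : TruncPoly O n} :
    f ∈ heller ε n i ↔ ∃ g : TruncPoly O n, x O n ^ i * f = eps ε n * g := by
  simp only [heller, coverMap, LinearMap.mem_ker, LinearMap.comp_apply, Submodule.mkQ_apply,
    LinearMap.mulLeft_apply, Submodule.Quotient.mk_eq_zero, Ideal.mem_span_singleton]
  rfl

theorem x_pow_eq_zero {k : ℕ} (hk : n ≤ k) : x O n ^ k = 0 := by
  have h : x O n ^ n = 0 := by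
    rw [x, ← AdjoinRoot.mk_X, ← map_pow, AdjoinRoot.mk_self]
  exact pow_eq_zero_of_le hk h

/-- `π(f, g) = X^{n-i} f - ε g`, as a map `A ⊕ A → Z_i`. -/
noncomputable def piMap (i : ℕ) (hin : i < n) :
    TruncPoly O n × TruncPoly O n →ₗ[TruncPoly O n] heller ε n i :=
  LinearMap.codRestrict (heller ε n i)
    (LinearMap.mulLeft (TruncPoly O n) (x O n ^ (n - i)) ∘ₗ LinearMap.fst _ _ _
      - LinearMap.mulLeft (TruncPoly O n) (eps ε n) ∘ₗ LinearMap.snd _ _ _)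
    (by
      rintro ⟨f, g⟩
      refine (mem_heller ε n).2 ⟨-(x O n ^ i * g), ?_⟩
      have h : x O n ^ i * x O n ^ (n - i) = 0 := by
        rw [← pow_add]; exact x_pow_eq_zero n (by omega)
      simp only [LinearMap.sub_apply, LinearMap.comp_apply, LinearMap.fst_apply,
        LinearMap.snd_apply, LinearMap.mulLeft_apply]
      linear_combination f * h)

end

theorem eps_mul_cancel {O : Type u} [CommRing O] [IsDomain O] {ε : O} (hε : ε ≠ 0) {n : ℕ}
    {f g : TruncPoly O n} (h : eps ε n * f = eps ε n * g) : f = g := by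
  have : Module.Free O (TruncPoly O n) := (monic_X_pow n).free_adjoinRoot
  rw [← Algebra.smul_def, ← Algebra.smul_def] at h
  exact smul_right_injective _ hε h

theorem exists_phi {O : Type u} [CommRing O] [IsDomain O] {ε : O} (hε : ε ≠ 0) {n i : ℕ}
    (hi : 0 < i) (hin : i < n) (h : heller ε n i) :
    ∃ y : heller ε n i, eps ε n * (y : TruncPoly O n) = x O n ^ (n - 1) * h := by
  obtain ⟨g, hg⟩ := (mem_heller ε n).1 h.2
  have h1 : x O n ^ (n - 1) = x O n ^ (n - 1 - i) * x O n ^ i := by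
    rw [← pow_add]; congr 1; omega
  have h2 : eps ε n * (x O n ^ (n - 1 - i) * g) = x O n ^ (n - 1) * h := by
    rw [h1, mul_assoc, hg]; ring
  refine ⟨⟨x O n ^ (n - 1 - i) * g, (mem_heller ε n).2 ⟨0, ?_⟩⟩, h2⟩
  apply eps_mul_cancel hε
  have h3 : x O n ^ i * x O n ^ (n - 1) = 0 := by
    rw [← pow_add]; exact x_pow_eq_zero n (by omega)
  linear_combination x O n ^ i * h2 + (h : TruncPoly O n) * h3

/-- The endomorphism `φ` of `Z_i`, `φ(h) = X^{n-1} h / ε`. It is the `A`-linear map with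
`φ(ε) = X^{n-1}` that kills `ε X^j` for `0 < j < n - i` and `X^j` for `n - i ≤ j`. -/
noncomputable def phi {O : Type u} [CommRing O] [IsDomain O] {ε : O} (hε : ε ≠ 0) {n i : ℕ}
    (hi : 0 < i) (hin : i < n) : heller ε n i →ₗ[TruncPoly O n] heller ε n i where
  toFun h := (exists_phi hε hi hin h).choose
  map_add' a b := by
    apply Subtype.ext
    apply eps_mul_cancel hε
    have hab := (exists_phi hε hi hin (a + b)).choose_spec
    have ha := (exists_phi hε hi hin a).choose_spec
    have hb := (exists_phi hε hi hin b).choose_spec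
    rw [hab, Submodule.coe_add, Submodule.coe_add, mul_add, mul_add, ha, hb]
  map_smul' c a := by
    apply Subtype.ext
    apply eps_mul_cancel hε
    have hca := (exists_phi hε hi hin (c • a)).choose_spec
    have ha := (exists_phi hε hi hin a).choose_spec
    rw [hca, RingHom.id_apply, Submodule.coe_smul, Submodule.coe_smul, smul_eq_mul, smul_eq_mul,
      mul_left_comm, mul_left_comm _ c, ha]

theorem eps_mul_phi {O : Type u} [CommRing O] [IsDomain O] {ε : O} (hε : ε ≠ 0) {n i : ℕ}
    (hi : 0 < i) (hin : i < n) (h : heller ε n i) :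
    eps ε n * (phi hε hi hin h : TruncPoly O n) = x O n ^ (n - 1) * h :=
  (exists_phi hε hi hin h).choose_spec

/-- The lattice `E_i = {(f, g, h) ∈ A ⊕ A ⊕ Z_i ∣ π(f, g) = φ(h)}`, the pullback of `π` along `φ`;
for `0 < i < n` it is the middle term of the almost split sequence ending at `Z_i`. -/
noncomputable def latticeE {O : Type u} [CommRing O] [IsDomain O] {ε : O} (hε : ε ≠ 0) {n i : ℕ}
    (hi : 0 < i) (hin : i < n) :
    Submodule (TruncPoly O n) ((TruncPoly O n × TruncPoly O n) × heller ε n i) :=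
  LinearMap.eqLocus (piMap ε n i hin ∘ₗ LinearMap.fst _ _ _)
    (phi hε hi hin ∘ₗ LinearMap.snd _ _ _)

end TruncPoly

/-! Put `r = i - 1` and `s = n - i - 1`; the bounds on `i` say exactly that `r, s ≥ 1`. In
coefficients `Z_i` is the ideal `(ε, X^(s+1))`, and forgetting `g` identifies `E_i` with a lattice
`pairLattice ε n r s` of pairs `(f, h)` glued modulo `ε`. Exchanging `r` and `s` gives `E_{n-i}`.
The sequence is explicit: its middle term is `(ε, X^(r+1)) ⊕ T`, where `T` is the lattice
`tripleLattice` of glued triples `(q, f, h)`, and its right-hand map is `(e, (q, f, h)) ↦ (e + f,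
h)`. The ideal `(ε, X^(r+1))` is `Z_{n-i}`.

Indecomposability is linear algebra. An endomorphism acts on constant coefficients divided by `ε`
through a matrix over `O`, and an idempotent with zero matrix is zero. Comparing coefficients in the
relations among generators shows that, modulo `ε`, all diagonal entries agree and no nontrivial
permutation contributes to the determinant. Hence an idempotent matrix is `0` or `1`.

The heart is `exists_lift_sequenceProj`. A map `α : Y → E_i` lifts if and only if two linear forms
exist with prescribed values modulo `ε`; over the residue field the obstruction is a number attached
to each `g : E_i → Y`, namely the first diagonal entry of the matrix of `α g` modulo `ε`. If `α` is
radical, `α g` lies in the Jacobson radical, so this entry is not a unit and the obstruction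
vanishes. Conversely, a nonradical map from an indecomposable lattice is an isomorphism, and lifting
it would split the sequence.

Completeness of `O` makes endomorphism rings of indecomposable lattices local (`isLocalRing_end`),
which yields uniqueness of almost split sequences (`IsAlmostSplitSequence.unique`) and transfers the
computation to every such sequence. -/

section AdicComplete

/-! ### Completeness of finite free algebras and lifting of idempotents. -/

theorem isAdicComplete_span_of_basis {O : Type*} [CommRing O] {ε : O}
    [IsAdicComplete (Ideal.span {ε}) O] {C : Type*} [CommRing C] [Algebra O C]
    {ι : Type*} (b : Module.Basis ι O C) [Finite ι] :
    IsAdicComplete (Ideal.span {algebraMap O C ε}) C := by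
  have := Fintype.ofFinite ι
  -- Divisibility by `ε ^ m` is tested on coordinates, so separation and limits reduce to `O`.
  have key : ∀ (m : ℕ) (c : C), c ∈ (Ideal.span {algebraMap O C ε} ^ m • ⊤ : Ideal C) ↔
      ∀ j, b.repr c j ∈ (Ideal.span {ε} ^ m • ⊤ : Ideal O) := by
    intro m c
    simp only [smul_eq_mul, Ideal.mul_top, Ideal.span_singleton_pow, Ideal.mem_span_singleton]
    rw [← map_pow]
    constructor
    · rintro ⟨d, rfl⟩ j
      rw [← Algebra.smul_def, map_smul, Finsupp.smul_apply, smul_eq_mul]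
      exact dvd_mul_right _ _
    · intro h
      choose d hd using h
      refine ⟨∑ j, d j • b j, ?_⟩
      rw [← Algebra.smul_def, Finset.smul_sum, ← b.sum_repr c]
      refine Finset.sum_congr rfl fun j _ => ?_
      rw [hd j, smul_smul]
  refine { haus' := fun c hc => ?_, prec' := fun f hf => ?_ }
  · apply b.repr.injective
    ext j
    rw [map_zero, Finsupp.zero_apply]
    refine IsHausdorff.haus' (I := Ideal.span {ε}) _ fun m => ?_
    have := hc m
    rw [SModEq.zero, key] at this
    rw [SModEq.zero]
    exact this j
  · have hj : ∀ j, ∃ L, ∀ m, b.repr (f m) j ≡ L [SMOD (Ideal.span {ε} ^ m • ⊤ : Ideal O)] := by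
      intro j
      refine IsPrecomplete.prec' (I := Ideal.span {ε}) (fun m => b.repr (f m) j) ?_
      intro m k hmk
      have := hf hmk
      rw [SModEq.sub_mem, key] at this
      rw [SModEq.sub_mem]
      simpa using this j
    choose L hL using hj
    refine ⟨∑ j, L j • b j, fun m => ?_⟩
    rw [SModEq.sub_mem, key]
    intro j
    have := hL j m
    rw [SModEq.sub_mem] at this
    rw [map_sub, Finsupp.sub_apply, b.repr_sum_self]
    exact this

/-- Idempotents lift along `R → R ⧸ I` when `R` is Henselian at `I`. -/
theorem exists_isIdempotentElem_sub_mem {R : Type*} [CommRing R] {I : Ideal R} [HenselianRing R I]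
    {a : R} (ha : a * a - a ∈ I) : ∃ e : R, IsIdempotentElem e ∧ e - a ∈ I := by
  by_cases hI : I = ⊤
  · exact ⟨0, by simp [IsIdempotentElem], by simp [hI]⟩
  have : Nontrivial R := by
    by_contra h
    rw [not_nontrivial_iff_subsingleton] at h
    exact hI (Subsingleton.elim _ _)
  obtain ⟨e, he, hea⟩ := HenselianRing.is_henselian (I := I) (X ^ 2 - X : R[X])
    (monic_X_pow_sub (by simp)) a (by simpa [pow_two] using ha) (by
      -- The derivative `2a - 1` is its own inverse modulo `I`, because `(2a - 1)^2 = 1 + 4(a^2 -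
      -- a)`.
      refine isUnit_iff_exists_inv.2 ⟨Ideal.Quotient.mk I (2 * a - 1), ?_⟩
      rw [← map_mul, ← map_one (Ideal.Quotient.mk I), Ideal.Quotient.eq]
      have h4 := I.mul_mem_left 4 ha
      convert! h4 using 1
      simp
      ring)
  refine ⟨e, ?_, hea⟩
  have : e ^ 2 - e = 0 := by simpa using he
  rw [IsIdempotentElem]
  linear_combination this

/-- Every element of a commutative Artinian ring has a power that generates the same
ideal as an idempotent. -/
theorem exists_pow_eq_pow_mul_idempotent {R : Type*} [CommRing R] [IsArtinianRing R] (t : R) :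
    ∃ (m : ℕ) (c : R), 0 < m ∧ (t ^ m * c) * (t ^ m * c) = t ^ m * c ∧
      t ^ m * (t ^ m * c) = t ^ m := by
  obtain ⟨m, c, h⟩ := IsArtinian.exists_pow_succ_smul_dvd t (1 : R)
  simp only [smul_eq_mul, mul_one] at h
  have h1 : ∀ k : ℕ, t ^ m * (t ^ k * c ^ k) = t ^ m := by
    intro k
    induction k with
    | zero => simp
    | succ k ih =>
      calc t ^ m * (t ^ (k + 1) * c ^ (k + 1)) = (t ^ m.succ * c) * (t ^ k * c ^ k) := by
            rw [Nat.succ_eq_add_one]; ring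
        _ = t ^ m * (t ^ k * c ^ k) := by rw [h]
        _ = t ^ m := ih
  have h2 : t ^ (m + 1) * (t ^ (m + 1) * c ^ (m + 1)) = t ^ (m + 1) := by
    rw [pow_succ' t m]
    linear_combination t * h1 (m + 1)
  -- The shift from `m` to `m + 1` only ensures a positive exponent.
  refine ⟨m + 1, c ^ (m + 1), by omega, ?_, h2⟩
  linear_combination c ^ (m + 1) * h2

end AdicComplete


/-! ### Endomorphism rings of indecomposable lattices are local. -/

section LocalEndomorphisms

/-- Fitting's dichotomy for an endomorphism `f` of a lattice: some idempotent endomorphism vanishes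
only if `1 - f` is invertible, and is the identity only if `f` is invertible. -/
theorem exists_idempotent_of_moduleEnd {O : Type u} {A : Type u} [CommRing O] [IsDomain O]
    [IsDiscreteValuationRing O]
    [IsAdicComplete (IsLocalRing.maximalIdeal O) O] [CommRing A] [Algebra O A]
    {M : Type u} [AddCommGroup M] [Module O M] [Module A M] [IsScalarTower O A M]
    [Module.Finite O M] [Module.Free O M] (f : Module.End A M) :
    ∃ e : Module.End A M, e * e = e ∧ (e = 0 → IsUnit (1 - f)) ∧ (e = 1 → IsUnit f) := by
  -- By Cayley–Hamilton, `f` is the image of the root in `C = O[X]/(p)`, a finite free and hence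
  -- complete `O`-algebra. The idempotent is found in the Artinian reduction of `C` and lifted.
  let p : O[X] := (f.restrictScalars O).charpoly
  have hp : p.Monic := LinearMap.charpoly_monic _
  have hpf : aeval f p = 0 := by
    ext m
    let ψ : Module.End A M →ₐ[O] Module.End O M :=
      { toFun := fun g => g.restrictScalars O
        map_one' := rfl
        map_mul' := fun _ _ => rfl
        map_zero' := rfl
        map_add' := fun _ _ => rfl
        commutes' := fun _ => rfl }
    have h := LinearMap.aeval_self_charpoly (f.restrictScalars O)
    have h2 : ψ (aeval f p) = 0 := by
      rw [← aeval_algHom_apply]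
      exact h
    exact LinearMap.congr_fun h2 m
  let C := AdjoinRoot p
  let φ : C →+* Module.End A M := Ideal.Quotient.lift (Ideal.span {p}) (aeval f).toRingHom (by
    intro a ha
    obtain ⟨q, rfl⟩ := Ideal.mem_span_singleton.1 ha
    simp [hpf])
  have hφ : φ (AdjoinRoot.root p) = f := by
    change (aeval f) X = f
    simp
  obtain ⟨ε, hε⟩ := IsDiscreteValuationRing.exists_irreducible O
  have hm : IsLocalRing.maximalIdeal O = Ideal.span {ε} := hε.maximalIdeal_eq
  let I : Ideal C := (IsLocalRing.maximalIdeal O).map (algebraMap O C)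
  have : IsAdicComplete (Ideal.span {ε}) O := hm ▸ inferInstance
  have : IsAdicComplete I C := by
    have := isAdicComplete_span_of_basis (ε := ε) (AdjoinRoot.powerBasis' hp).basis
    simpa only [I, hm, Ideal.map_span, Set.image_singleton] using this
  have : Module.Finite O C := hp.finite_adjoinRoot
  have hArt : IsArtinianRing (C ⧸ I) := by
    let _ : Field (O ⧸ IsLocalRing.maximalIdeal O) := Ideal.Quotient.field _
    have : Module.Finite (O ⧸ IsLocalRing.maximalIdeal O) (C ⧸ I) :=
      Module.Finite.of_restrictScalars_finite O _ _
    exact IsArtinianRing.of_finite (O ⧸ IsLocalRing.maximalIdeal O) (C ⧸ I)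
  set t : C := AdjoinRoot.root p
  obtain ⟨m, c, hm0, h1, h2⟩ := exists_pow_eq_pow_mul_idempotent (Ideal.Quotient.mk I t)
  obtain ⟨c, rfl⟩ := Ideal.Quotient.mk_surjective c
  rw [← map_pow, ← map_mul, ← map_mul, Ideal.Quotient.eq] at h1 h2
  obtain ⟨e, he, hec⟩ := exists_isIdempotentElem_sub_mem h1
  have hjac : ∀ d ∈ I, IsUnit (1 + d) := by
    intro d hd
    have := Ideal.mem_jacobson_bot.1 (IsAdicComplete.le_jacobson_bot I hd) 1
    rwa [mul_one, add_comm] at this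
  refine ⟨φ e, by rw [← map_mul, he.eq], fun h0 => ?_, fun h0 => ?_⟩
  -- If `e` acts as zero, the unit `1 + (t^m e - t^m)` acts as `1 - f^m`, a multiple of `1 - f`.
  · have h3 : t ^ m * e - t ^ m ∈ I := by
      have := I.add_mem (I.mul_mem_left (t ^ m) hec) h2
      convert! this using 1
      ring
    have h4 : IsUnit (1 - f ^ m) := by
      have := (hjac _ h3).map φ
      rw [map_add, map_sub, map_mul, h0, map_pow, hφ, map_one] at this
      simpa [sub_eq_add_neg] using this
    have hc : Commute (1 - f) (∑ i ∈ Finset.range m, f ^ i) := by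
      refine Commute.sum_right _ _ _ fun i _ => ?_
      exact ((Commute.one_left f).sub_left (Commute.refl f)).pow_right i
    rw [← mul_neg_geom_sum] at h4
    exact (hc.isUnit_mul_iff.1 h4).1
  -- If `e` acts as the identity, the unit `1 - (e - t^m c)` acts as `t^m c`.
  · have h4 : IsUnit (φ (t ^ m * c)) := by
      have h5 := (hjac _ (I.neg_mem hec)).map φ
      have h6 : φ (1 + -(e - t ^ m * c)) = φ (t ^ m * c) := by
        rw [map_add, map_neg, map_sub, h0, map_one]
        abel
      rwa [h6] at h5
    rw [map_mul] at h4
    have h5 : IsUnit (φ (t ^ m)) :=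
      (((Commute.all (t ^ m) c).map φ).isUnit_mul_iff.1 h4).1
    rw [map_pow, hφ] at h5
    exact (isUnit_pow_iff hm0.ne').1 h5

section Indecomposable

variable {A M : Type u} [Ring A] [AddCommGroup M] [Module A M]

theorem IsIndecomposableModule.eq_zero_or_one (h : IsIndecomposableModule A M)
    {e : Module.End A M} (he : e * e = e) : e = 0 ∨ e = 1 := by
  have hi : IsIdempotentElem e := he
  rcases h.eq_bot_or_eq_bot _ _ (LinearMap.IsIdempotentElem.isCompl hi) with h | h
  · exact Or.inl (LinearMap.range_eq_bot.1 h)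
  · right
    have : Function.Injective e := LinearMap.ker_eq_bot.1 h
    ext m
    exact this (LinearMap.congr_fun he m)

theorem isIndecomposableModule_of_idempotents [Nontrivial M]
    (h : ∀ e : Module.End A M, e * e = e → e = 0 ∨ e = 1) : IsIndecomposableModule A M := by
  refine ⟨inferInstance, fun P Q hPQ => ?_⟩
  have hid : P.projection Q hPQ * P.projection Q hPQ = P.projection Q hPQ :=
    Submodule.isIdempotentElem_projection hPQ
  rcases h _ hid with h | h
  · left
    rw [← Submodule.range_projection hPQ, h, LinearMap.range_zero]
  · right
    rw [← Submodule.ker_projection hPQ, h]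
    exact LinearMap.ker_id

theorem IsIndecomposableModule.of_linearEquiv {N : Type u} [AddCommGroup N] [Module A N]
    (h : IsIndecomposableModule A M) (e : M ≃ₗ[A] N) : IsIndecomposableModule A N := by
  refine ⟨e.symm.toEquiv.nontrivial_congr.2 h.nontrivial, fun P Q hPQ => ?_⟩
  have h1 : IsCompl (P.comap (e : M →ₗ[A] N)) (Q.comap (e : M →ₗ[A] N)) := by
    exact hPQ.map (Submodule.orderIsoMapComap e).symm
  rcases h.eq_bot_or_eq_bot _ _ h1 with h | h
  · left
    exact (map_eq_bot_iff (Submodule.orderIsoMapComap e).symm).1 h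
  · right
    exact (map_eq_bot_iff (Submodule.orderIsoMapComap e).symm).1 h

end Indecomposable

variable {O : Type u} {A : Type u} [CommRing O] [IsDomain O] [IsDiscreteValuationRing O]
    [IsAdicComplete (IsLocalRing.maximalIdeal O) O] [CommRing A] [Algebra O A]

theorem isLocalRing_end {M : Type u} [AddCommGroup M] [Module O M] [Module A M]
    [IsScalarTower O A M] (hl : IsALattice O A M) (h : IsIndecomposableModule A M) :
    IsLocalRing (Module.End A M) := by
  have := hl.finite
  have := hl.free
  have := h.nontrivial
  refine IsLocalRing.of_isUnit_or_isUnit_one_sub_self fun f => ?_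
  obtain ⟨e, he, h0, h1⟩ := exists_idempotent_of_moduleEnd (O := O) f
  rcases h.eq_zero_or_one he with h | h
  · exact Or.inr (h0 h)
  · exact Or.inl (h1 h)

/-- If `x` is not a unit then neither is any `-(y * x)`, since a left inverse of `x` is two-sided by
`hid`; locality then makes each `1 + y * x` invertible. -/
theorem mem_jacobson_of_not_isUnit {R : Type*} [Ring R] [IsLocalRing R] {x : R} (hx : ¬ IsUnit x)
    (hid : ∀ a b : R, a * b = 1 → b * a = 1) :
    x ∈ Ring.jacobson R := by
  rw [← Ideal.jacobson_bot, Ideal.mem_jacobson_iff]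
  intro y
  have h1 : ¬ IsUnit (-(y * x)) := by
    rintro ⟨u, hu⟩
    apply hx
    have h2 : (-(↑u⁻¹ * y)) * x = 1 := by
      have : (↑u⁻¹ : R) * ↑u = 1 := u.inv_mul
      rw [hu] at this
      rw [← this]
      noncomm_ring
    exact ⟨⟨x, _, hid _ _ h2, h2⟩, rfl⟩
  obtain ⟨u, hu⟩ := (IsLocalRing.isUnit_or_isUnit_of_add_one
    (add_sub_cancel (-(y * x)) (1 : R))).resolve_left h1
  refine ⟨↑u⁻¹, ?_⟩
  rw [Ideal.mem_bot, sub_eq_zero]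
  have : (↑u⁻¹ : R) * ↑u = 1 := u.inv_mul
  rw [hu] at this
  rw [← this]
  noncomm_ring

theorem isUnit_one_sub_of_mem_jacobson {R : Type*} [Ring R] {x : R} (hx : x ∈ Ring.jacobson R)
    (y : R) (hid : ∀ a b : R, a * b = 1 → b * a = 1) : IsUnit (1 - y * x) := by
  rw [← Ideal.jacobson_bot, Ideal.mem_jacobson_iff] at hx
  obtain ⟨z, hz⟩ := hx (-y)
  rw [Ideal.mem_bot, sub_eq_zero] at hz
  have h2 : z * (1 - y * x) = 1 := by
    refine Eq.trans ?_ hz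
    noncomm_ring
  exact ⟨⟨_, z, hid _ _ h2, h2⟩, rfl⟩

/-- The idempotent `b * a` cannot vanish, as `1 = a * (b * a) * b`. -/
theorem IsIndecomposableModule.mul_eq_one_comm {M : Type u} [AddCommGroup M] [Module A M]
    (h : IsIndecomposableModule A M) (a b : Module.End A M) (hab : a * b = 1) : b * a = 1 := by
  have h1 : (b * a) * (b * a) = b * a := by
    rw [mul_assoc, ← mul_assoc a b a, hab, one_mul]
  rcases h.eq_zero_or_one h1 with h0 | h0
  · have := h.nontrivial
    exfalso
    have : (1 : Module.End A M) = 0 := by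
      calc (1 : Module.End A M) = (a * b) * (a * b) := by rw [hab, one_mul]
        _ = a * (b * a) * b := by noncomm_ring
        _ = 0 := by rw [h0]; simp
    exact one_ne_zero this
  · exact h0

/-- A homomorphism between indecomposable lattices that is not radical is invertible. -/
theorem exists_inverse_of_not_isRadicalHom {X M : Type u} [AddCommGroup X] [Module A X]
    [AddCommGroup M] [Module A M] (hX : IsIndecomposableModule A X)
    (hM : IsIndecomposableModule A M) {f : X →ₗ[A] M} (hf : ¬ IsRadicalHom O A f) :
    ∃ s : M →ₗ[A] X, f ∘ₗ s = LinearMap.id ∧ s ∘ₗ f = LinearMap.id := by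
  unfold IsRadicalHom at hf
  push Not at hf
  obtain ⟨Y, _, _, _, _, hYl, hY, g, h, hgh⟩ := hf
  have := isLocalRing_end hYl hY
  have hY0 := hY.nontrivial
  have hu : IsUnit (h ∘ₗ f ∘ₗ g : Module.End A Y) := by
    by_contra hu
    exact hgh (mem_jacobson_of_not_isUnit hu hY.mul_eq_one_comm)
  obtain ⟨u, hu⟩ := hu
  have h1 : ∀ y, h (f (g ((↑u⁻¹ : Module.End A Y) y))) = y := by
    intro y
    have : (↑u : Module.End A Y) * ↑u⁻¹ = 1 := u.mul_inv
    rw [hu] at this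
    exact LinearMap.congr_fun this y
  -- With `u = h f g` invertible, `s = g u⁻¹ h` makes both `f s` and `s f` nonzero idempotents,
  -- hence identities.
  let s : M →ₗ[A] X := g ∘ₗ (↑u⁻¹ : Module.End A Y) ∘ₗ h
  have hs : ∀ m, s m = g ((↑u⁻¹ : Module.End A Y) (h m)) := fun _ => rfl
  obtain ⟨y, hy⟩ := exists_ne (0 : Y)
  have e1 : (f ∘ₗ s : Module.End A M) * (f ∘ₗ s) = f ∘ₗ s := by
    ext m
    change f (s (f (s m))) = f (s m)
    simp only [hs, h1]
  have e2 : (s ∘ₗ f : Module.End A X) * (s ∘ₗ f) = s ∘ₗ f := by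
    ext m
    change s (f (s (f m))) = s (f m)
    simp only [hs, h1]
  refine ⟨s, ?_, ?_⟩
  · refine (hM.eq_zero_or_one e1).resolve_left fun h0 => hy ?_
    have := LinearMap.congr_fun h0 (f (g ((↑u⁻¹ : Module.End A Y) y)))
    change f (s _) = 0 at this
    rw [hs, h1] at this
    rw [← h1 y, this, map_zero]
  · refine (hX.eq_zero_or_one e2).resolve_left fun h0 => hy ?_
    have := LinearMap.congr_fun h0 (g ((↑u⁻¹ : Module.End A Y) y))
    change s (f _) = 0 at this
    rw [hs, h1] at this
    rw [← h1 y, this, map_zero, map_zero]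

end LocalEndomorphisms

/-! ### Stability properties of lattices and reduction to indecomposables. -/

section Lattices

variable {O : Type u} {A : Type u} [CommRing O] [CommRing A] [Algebra O A]

theorem IsALattice.of_linearEquiv {M N : Type u} [AddCommGroup M] [Module O M] [Module A M]
    [IsScalarTower O A M] [AddCommGroup N] [Module O N] [Module A N] [IsScalarTower O A N]
    (h : IsALattice O A M) (e : M ≃ₗ[A] N) : IsALattice O A N := by
  have := h.finite
  have := h.free
  exact ⟨Module.Finite.equiv (e.restrictScalars O), Module.Free.of_equiv (e.restrictScalars O)⟩

theorem IsALattice.submodule [IsDomain O] [IsPrincipalIdealRing O] {M : Type u} [AddCommGroup M]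
    [Module O M] [Module A M] [IsScalarTower O A M] (h : IsALattice O A M) (P : Submodule A M) :
    IsALattice O A P := by
  have := h.finite
  have := h.free
  exact ⟨inferInstanceAs (Module.Finite O (P.restrictScalars O)),
    inferInstanceAs (Module.Free O (P.restrictScalars O))⟩

theorem IsALattice.prod {M N : Type u} [AddCommGroup M] [Module O M] [Module A M]
    [IsScalarTower O A M] [AddCommGroup N] [Module O N] [Module A N] [IsScalarTower O A N]
    (h : IsALattice O A M) (h' : IsALattice O A N) : IsALattice O A (M × N) := by
  have := h.finite
  have := h.free
  have := h'.finite
  have := h'.free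
  exact ⟨inferInstance, inferInstance⟩

theorem IsRadicalHom.comp_left {M N P : Type u} [AddCommGroup M] [Module A M] [AddCommGroup N]
    [Module A N] [AddCommGroup P] [Module A P] {f : M →ₗ[A] N} (hf : IsRadicalHom O A f)
    (k : N →ₗ[A] P) : IsRadicalHom O A (k ∘ₗ f) :=
  fun Y _ _ _ _ hYl hY g h => hf Y hYl hY g (h ∘ₗ k)

/-- A homomorphism from a lattice lifts along `p` as soon as its restrictions to indecomposable
lattices do. -/
theorem exists_lift_of_indecomposable [IsDomain O] [IsPrincipalIdealRing O]
    {E M : Type u} [AddCommGroup E] [Module A E] [AddCommGroup M] [Module A M] (p : E →ₗ[A] M) :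
    ∀ (d : ℕ) (F : Type u) [AddCommGroup F] [Module O F] [Module A F] [IsScalarTower O A F],
      IsALattice O A F → Module.finrank O F = d → ∀ f : F →ₗ[A] M,
      (∀ (X : Type u) [AddCommGroup X] [Module O X] [Module A X] [IsScalarTower O A X],
        IsALattice O A X → IsIndecomposableModule A X → ∀ r : X →ₗ[A] F,
          ∃ g : X →ₗ[A] E, p ∘ₗ g = f ∘ₗ r) →
      ∃ g : F →ₗ[A] E, p ∘ₗ g = f := by
  intro d
  induction d using Nat.strong_induction_on with
  | _ d ih =>
    intro F _ _ _ _ hF hd f hf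
    by_cases hind : IsIndecomposableModule A F
    · exact hf F hF hind LinearMap.id
    rcases subsingleton_or_nontrivial F with hs | hn
    · exact ⟨0, by ext x; rw [Subsingleton.elim x 0, map_zero, map_zero]⟩
    obtain ⟨P, Q, hPQ, hP, hQ⟩ : ∃ P Q : Submodule A F, IsCompl P Q ∧ P ≠ ⊥ ∧ Q ≠ ⊥ := by
      by_contra hcon
      push Not at hcon
      exact hind ⟨hn, fun P Q hPQ => or_iff_not_imp_left.2 (hcon P Q hPQ)⟩
    have hPl := hF.submodule P
    have hQl := hF.submodule Q
    have i1 := hPl.finite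
    have i2 := hPl.free
    have i3 := hQl.finite
    have i4 := hQl.free
    have hsum : Module.finrank O P + Module.finrank O Q = d := by
      rw [← hd, ← Module.finrank_prod]
      exact ((Submodule.prodEquivOfIsCompl P Q hPQ).restrictScalars O).finrank_eq
    have hP0 : 0 < Module.finrank O P := by
      have := Submodule.nontrivial_iff_ne_bot.2 hP
      exact Module.finrank_pos
    have hQ0 : 0 < Module.finrank O Q := by
      have := Submodule.nontrivial_iff_ne_bot.2 hQ
      exact Module.finrank_pos
    obtain ⟨g1, hg1⟩ := ih _ (by omega) P hPl rfl (f ∘ₗ P.subtype)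
      (fun X _ _ _ _ hXl hX r => hf X hXl hX (P.subtype ∘ₗ r))
    obtain ⟨g2, hg2⟩ := ih _ (by omega) Q hQl rfl (f ∘ₗ Q.subtype)
      (fun X _ _ _ _ hXl hX r => hf X hXl hX (Q.subtype ∘ₗ r))
    refine ⟨LinearMap.ofIsCompl hPQ g1 g2, ?_⟩
    ext x
    obtain ⟨⟨a, b⟩, rfl⟩ := (Submodule.prodEquivOfIsCompl P Q hPQ).surjective x
    have e1 := LinearMap.congr_fun hg1 a
    have e2 := LinearMap.congr_fun hg2 b
    simp only [LinearMap.comp_apply, Submodule.coe_prodEquivOfIsCompl', map_add,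
      LinearMap.ofIsCompl_apply_left, LinearMap.ofIsCompl_apply_right,
      Submodule.subtype_apply] at e1 e2 ⊢
    rw [e1, e2]

end Lattices

/-! ### Uniqueness of almost split sequences. -/

section AlmostSplit

variable {O : Type u} {A : Type u} [CommRing O] [CommRing A] [Algebra O A]

theorem IsAlmostSplitSequence.of_linearEquiv {L E M L' M' : Type u}
    [AddCommGroup L] [Module O L] [Module A L] [IsScalarTower O A L]
    [AddCommGroup E] [Module O E] [Module A E] [IsScalarTower O A E]
    [AddCommGroup M] [Module O M] [Module A M] [IsScalarTower O A M]
    [AddCommGroup L'] [Module O L'] [Module A L'] [IsScalarTower O A L']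
    [AddCommGroup M'] [Module O M'] [Module A M'] [IsScalarTower O A M']
    {ι : L →ₗ[A] E} {p : E →ₗ[A] M} (h : IsAlmostSplitSequence O A ι p)
    (e : L' ≃ₗ[A] L) (e' : M ≃ₗ[A] M') :
    IsAlmostSplitSequence O A (ι ∘ₗ (e : L' →ₗ[A] L)) ((e' : M →ₗ[A] M') ∘ₗ p) where
  lattice_left := h.lattice_left.of_linearEquiv e.symm
  lattice_middle := h.lattice_middle
  lattice_right := h.lattice_right.of_linearEquiv e'
  injective := h.injective.comp e.injective
  exact := by
    intro x
    simp only [LinearMap.comp_apply, LinearEquiv.coe_coe, EmbeddingLike.map_eq_zero_iff]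
    rw [h.exact x]
    constructor
    · rintro ⟨y, rfl⟩
      exact ⟨e.symm y, by simp⟩
    · rintro ⟨y, rfl⟩
      exact ⟨e y, by simp⟩
  surjective := e'.surjective.comp h.surjective
  not_split := by
    rintro ⟨s, hs⟩
    refine h.not_split ⟨s ∘ₗ (e' : M →ₗ[A] M'), ?_⟩
    ext m
    have := LinearMap.congr_fun hs (e' m)
    exact e'.injective this
  indecomposable_left := h.indecomposable_left.of_linearEquiv e.symm
  indecomposable_right := h.indecomposable_right.of_linearEquiv e'
  factor_iff := by
    intro X _ _ _ _ hXl hX f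
    have h1 : IsRadicalHom O A f ↔ IsRadicalHom O A ((e'.symm : M' →ₗ[A] M) ∘ₗ f) := by
      refine ⟨fun hf => hf.comp_left _, fun hf => ?_⟩
      have := hf.comp_left (e' : M →ₗ[A] M')
      rwa [← LinearMap.comp_assoc, LinearEquiv.comp_coe, LinearEquiv.symm_trans_self,
        LinearEquiv.refl_toLinearMap, LinearMap.id_comp] at this
    rw [h1, h.factor_iff X hXl hX]
    refine exists_congr fun g => ?_
    constructor
    · intro hg
      rw [LinearMap.comp_assoc, hg]
      ext x
      simp
    · rintro rfl
      ext x
      simp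

variable {L E M : Type u}
    [AddCommGroup L] [Module O L] [Module A L] [IsScalarTower O A L]
    [AddCommGroup E] [Module O E] [Module A E] [IsScalarTower O A E]
    [AddCommGroup M] [Module O M] [Module A M] [IsScalarTower O A M]

/-- Being radical depends only on the homomorphism: composites of `p'` with maps from
indecomposables are radical because of `h'`, so they lift along `p` because of `h`. -/
theorem IsAlmostSplitSequence.exists_factor [IsDomain O] [IsPrincipalIdealRing O]
    {ι : L →ₗ[A] E} {p : E →ₗ[A] M} (h : IsAlmostSplitSequence O A ι p)
    {L' E' : Type u} [AddCommGroup L'] [Module O L'] [Module A L'] [IsScalarTower O A L']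
    [AddCommGroup E'] [Module O E'] [Module A E'] [IsScalarTower O A E']
    {ι' : L' →ₗ[A] E'} {p' : E' →ₗ[A] M} (h' : IsAlmostSplitSequence O A ι' p') :
    ∃ a : E' →ₗ[A] E, p ∘ₗ a = p' :=
  exists_lift_of_indecomposable (O := O) p _ E' h'.lattice_middle rfl p'
    fun X _ _ _ _ hXl hX r => (h.factor_iff X hXl hX _).1 ((h'.factor_iff X hXl hX _).2 ⟨r, rfl⟩)

theorem exists_comp_eq_of_exact {X : Type u} [AddCommGroup X] [Module A X]
    {ι : L →ₗ[A] E} {p : E →ₗ[A] M} (hi : Function.Injective ι) (hex : Function.Exact ι p)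
    (f : X →ₗ[A] E) (hf : ∀ x, p (f x) = 0) : ∃ c : X →ₗ[A] L, ∀ x, ι (c x) = f x := by
  have h1 : ∀ x, f x ∈ LinearMap.range ι := fun x => (hex (f x)).1 (hf x)
  refine ⟨(LinearEquiv.ofInjective ι hi).symm ∘ₗ f.codRestrict (LinearMap.range ι) h1,
    fun x => ?_⟩
  have := LinearEquiv.apply_symm_apply (LinearEquiv.ofInjective ι hi)
    (f.codRestrict (LinearMap.range ι) h1 x)
  exact congrArg Subtype.val this

variable [IsDomain O] [IsDiscreteValuationRing O]
    [IsAdicComplete (IsLocalRing.maximalIdeal O) O]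

/-- `θ` induces `c` on `L`, and `1 - θ` factors as `ι d` with `d ι = 1 - c`. As `End L` is local,
`c` or `1 - c` is invertible; in the second case `ι` has a retraction and the sequence splits. So
`c` is invertible, and then so is `θ` by the five lemma. -/
theorem IsAlmostSplitSequence.bijective_of_comp_eq {ι : L →ₗ[A] E} {p : E →ₗ[A] M}
    (h : IsAlmostSplitSequence O A ι p) {θ : E →ₗ[A] E} (hθ : ∀ x, p (θ x) = p x) :
    Function.Bijective θ := by
  have hpi : ∀ l, p (ι l) = 0 := fun l => (h.exact _).2 ⟨l, rfl⟩
  obtain ⟨c, hc⟩ := exists_comp_eq_of_exact h.injective h.exact (θ ∘ₗ ι) (fun x => by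
    rw [LinearMap.comp_apply, hθ, hpi])
  obtain ⟨d, hd⟩ := exists_comp_eq_of_exact h.injective h.exact (LinearMap.id - θ) (fun x => by
    simp [hθ])
  have := isLocalRing_end h.lattice_left h.indecomposable_left
  have hunit : IsUnit (c : Module.End A L) := by
    refine (IsLocalRing.isUnit_or_isUnit_of_add_one
      (add_sub_cancel (c : Module.End A L) 1)).resolve_right ?_
    rintro ⟨w, hw⟩
    apply h.not_split
    have hdi : ∀ l, d (ι l) = (↑w : Module.End A L) l := by
      intro l
      apply h.injective
      rw [hd, hw]
      simp [hc]
    have hr : ((↑w⁻¹ : Module.End A L) ∘ₗ d) ∘ₗ ι = LinearMap.id := by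
      ext l
      change (↑w⁻¹ : Module.End A L) (d (ι l)) = l
      rw [hdi]
      exact LinearMap.congr_fun w.inv_mul l
    have htfae : (Function.Injective ι ∧ ∃ l, p ∘ₗ l = LinearMap.id) ↔
        (Function.Surjective p ∧ ∃ l, l ∘ₗ ι = LinearMap.id) := h.exact.split_tfae'.out 0 1
    exact (htfae.2 ⟨h.surjective, _, hr⟩).2
  have hcb : Function.Bijective c := (Module.End.isUnit_iff _).1 hunit
  constructor
  · rw [← LinearMap.ker_eq_bot, LinearMap.ker_eq_bot']
    intro x hx
    have : p x = 0 := by rw [← hθ, hx, map_zero]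
    obtain ⟨l, rfl⟩ := (h.exact x).1 this
    have h1 : ι (c l) = 0 := by rw [hc]; exact hx
    have h2 : c l = c 0 := h.injective (by rw [h1, map_zero, map_zero])
    rw [hcb.1 h2, map_zero]
  · intro x
    obtain ⟨l, hl⟩ := hcb.2 (d x)
    refine ⟨x + ι l, ?_⟩
    have h1 : θ (ι l) = ι (c l) := (hc l).symm
    rw [map_add, h1, hl, hd]
    simp

/-- An almost split sequence is determined by its right-hand term. -/
theorem IsAlmostSplitSequence.unique {ι : L →ₗ[A] E} {p : E →ₗ[A] M}
    (h : IsAlmostSplitSequence O A ι p)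
    {L' E' : Type u} [AddCommGroup L'] [Module O L'] [Module A L'] [IsScalarTower O A L']
    [AddCommGroup E'] [Module O E'] [Module A E'] [IsScalarTower O A E']
    {ι' : L' →ₗ[A] E'} {p' : E' →ₗ[A] M} (h' : IsAlmostSplitSequence O A ι' p') :
    Nonempty (L' ≃ₗ[A] L) ∧ Nonempty (E ≃ₗ[A] E') := by
  obtain ⟨a, ha⟩ := h.exists_factor h'
  obtain ⟨b, hb⟩ := h'.exists_factor h
  have ha' : ∀ x, p (a x) = p' x := LinearMap.congr_fun ha
  have hb' : ∀ x, p' (b x) = p x := LinearMap.congr_fun hb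
  have h1 := h.bijective_of_comp_eq (θ := a ∘ₗ b) (fun x => by
    rw [LinearMap.comp_apply, ha', hb'])
  have h2 := h'.bijective_of_comp_eq (θ := b ∘ₗ a) (fun x => by
    rw [LinearMap.comp_apply, hb', ha'])
  have hab : Function.Bijective a :=
    ⟨Function.Injective.of_comp (f := b) h2.1, Function.Surjective.of_comp (g := b) h1.2⟩
  let e := LinearEquiv.ofBijective a hab
  -- `a` commutes with the projections, so it carries one kernel onto the other.
  have hr : (LinearMap.range ι').map (e : E' →ₗ[A] E) = LinearMap.range ι := by
    ext x
    obtain ⟨y, rfl⟩ := e.surjective x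
    have e1 : ∀ y, p (e y) = p' y := ha'
    constructor
    · rintro ⟨_, ⟨l, rfl⟩, hl⟩
      rw [← hl]
      exact (h.exact _).1 ((e1 _).trans ((h'.exact _).2 ⟨l, rfl⟩))
    · intro hy
      have := (h.exact _).2 hy
      rw [e1] at this
      exact ⟨y, (h'.exact _).1 this, rfl⟩
  exact ⟨⟨(LinearEquiv.ofInjective ι' h'.injective).trans
    ((e.ofSubmodules _ _ hr).trans (LinearEquiv.ofInjective ι h.injective).symm)⟩, ⟨e.symm⟩⟩

end AlmostSplit

namespace TruncPoly

/-! ### Coefficients in the truncated polynomial ring. -/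

section Coefficients

variable {O : Type u} [CommRing O] {n : ℕ}

/-- The coefficient of `X ^ j` of an element of `O[X]/(X^n)`. -/
noncomputable def coeff (n j : ℕ) : TruncPoly O n →ₗ[O] O :=
  Polynomial.lcoeff O j ∘ₗ AdjoinRoot.modByMonicHom (monic_X_pow n)

theorem coeff_mk {j : ℕ} (hj : j < n) (p : O[X]) :
    coeff n j (AdjoinRoot.mk (X ^ n) p) = p.coeff j := by
  have h := modByMonic_add_div p (X ^ n)
  rw [coeff, LinearMap.comp_apply, AdjoinRoot.modByMonicHom_mk, lcoeff_apply]
  conv_rhs => rw [← h, Polynomial.coeff_add, coeff_X_pow_mul', if_neg (by omega), add_zero]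

theorem coeff_eq_zero_of_le {j : ℕ} (hj : n ≤ j) (a : TruncPoly O n) : coeff n j a = 0 := by
  nontriviality O
  obtain ⟨p, rfl⟩ := AdjoinRoot.mk_surjective a
  rw [coeff, LinearMap.comp_apply, AdjoinRoot.modByMonicHom_mk, lcoeff_apply]
  apply coeff_eq_zero_of_degree_lt
  refine (degree_modByMonic_lt p (monic_X_pow n)).trans_le ?_
  rw [degree_X_pow]
  exact_mod_cast hj

theorem exists_coeff_eq (n : ℕ) (g : ℕ → O) :
    ∃ a : TruncPoly O n, ∀ j < n, coeff n j a = g j := by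
  refine ⟨AdjoinRoot.mk (X ^ n) (∑ k ∈ Finset.range n, monomial k (g k)), fun j hj => ?_⟩
  rw [coeff_mk hj, finsetSum_coeff]
  simp [coeff_monomial, hj]

theorem ext_coeff {a b : TruncPoly O n} (h : ∀ j < n, coeff n j a = coeff n j b) : a = b := by
  rcases subsingleton_or_nontrivial O with hO | hO
  · have := Module.subsingleton O (TruncPoly O n)
    exact Subsingleton.elim _ _
  rw [← sub_eq_zero]
  replace h : ∀ j, coeff n j (a - b) = 0 := by
    intro j
    rcases lt_or_ge j n with hj | hj
    · rw [map_sub, h j hj, sub_self]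
    · exact coeff_eq_zero_of_le hj _
  obtain ⟨p, hp⟩ := AdjoinRoot.mk_surjective (a - b)
  rw [← hp] at h ⊢
  have h0 : p %ₘ (X ^ n) = 0 := by
    ext j
    have := h j
    rwa [coeff, LinearMap.comp_apply, AdjoinRoot.modByMonicHom_mk, lcoeff_apply] at this
  rw [AdjoinRoot.mk_eq_zero]
  exact (modByMonic_eq_zero_iff_dvd (monic_X_pow n)).1 h0

theorem coeff_x_pow_mul {j m : ℕ} (h : j + m < n) (a : TruncPoly O n) :
    coeff n (j + m) (x O n ^ m * a) = coeff n j a := by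
  obtain ⟨p, rfl⟩ := AdjoinRoot.mk_surjective a
  rw [x, ← AdjoinRoot.mk_X, ← map_pow, ← map_mul, coeff_mk h, coeff_mk (by omega),
    coeff_X_pow_mul]

theorem coeff_x_pow_mul' {l j m : ℕ} (hl : l < n) (h : j + m = l) (a : TruncPoly O n) :
    coeff n l (x O n ^ m * a) = coeff n j a := by
  subst h
  exact coeff_x_pow_mul hl a

theorem coeff_x_pow_mul_of_lt {j m : ℕ} (h : j < m) (a : TruncPoly O n) :
    coeff n j (x O n ^ m * a) = 0 := by
  rcases lt_or_ge j n with hj | hj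
  · obtain ⟨p, rfl⟩ := AdjoinRoot.mk_surjective a
    rw [x, ← AdjoinRoot.mk_X, ← map_pow, ← map_mul, coeff_mk hj, coeff_X_pow_mul',
      if_neg (by omega)]
  · exact coeff_eq_zero_of_le hj _

theorem coeff_eps_mul (ε : O) (j : ℕ) (a : TruncPoly O n) :
    coeff n j (eps ε n * a) = ε * coeff n j a := by
  rw [eps, ← Algebra.smul_def, map_smul, smul_eq_mul]

theorem coeff_eps_zero (hn : 0 < n) (ε : O) : coeff n 0 (eps ε n) = ε := by
  change coeff n 0 (AdjoinRoot.mk (X ^ n) (C ε)) = ε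
  rw [coeff_mk hn, coeff_C_zero]

theorem coeff_x_pow {m : ℕ} (hm : m < n) : coeff n m (x O n ^ m) = 1 := by
  rw [x, ← AdjoinRoot.mk_X, ← map_pow, coeff_mk hm, coeff_X_pow_self]

theorem eps_mul_eq_smul {M : Type*} [AddCommGroup M] [Module O M] [Module (TruncPoly O n) M]
    [IsScalarTower O (TruncPoly O n) M] (ε : O) (m : M) : eps ε n • m = ε • m := by
  rw [eps, algebraMap_smul]

/-- Elements of the ideal `(ε, X^m)` in terms of coefficients. -/
theorem exists_eq_of_dvd_coeff {ε : O} {m : ℕ} {f : TruncPoly O n}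
    (h : ∀ j < m, ε ∣ coeff n j f) : ∃ a b : TruncPoly O n, f = eps ε n * a + x O n ^ m * b := by
  have h' : ∀ j, ∃ c, j < m → coeff n j f = ε * c := by
    intro j
    by_cases hj : j < m
    · obtain ⟨c, hc⟩ := h j hj
      exact ⟨c, fun _ => hc⟩
    · exact ⟨0, fun h => absurd h hj⟩
  choose c hc using h'
  obtain ⟨a, ha⟩ := exists_coeff_eq n fun j => if j < m then c j else 0
  obtain ⟨b, hb⟩ := exists_coeff_eq n fun j => coeff n (j + m) f
  refine ⟨a, b, ext_coeff fun j hj => ?_⟩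
  rw [map_add, coeff_eps_mul, ha j hj]
  by_cases hjm : j < m
  · rw [if_pos hjm, coeff_x_pow_mul_of_lt hjm, add_zero, hc j hjm]
  · obtain ⟨l, rfl⟩ := Nat.exists_eq_add_of_le' (not_lt.1 hjm)
    rw [if_neg hjm, coeff_x_pow_mul hj, hb l (by omega), mul_zero, zero_add]

theorem dvd_coeff_of_lt {ε : O} {j m : ℕ} (h : j < m) (a b : TruncPoly O n) :
    ε ∣ coeff n j (eps ε n * a + x O n ^ m * b) := by
  rw [map_add, coeff_eps_mul, coeff_x_pow_mul_of_lt h, add_zero]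
  exact dvd_mul_right _ _

theorem exists_eq_of_dvd_coeff_sub {ε : O} {m : ℕ} {f d : TruncPoly O n}
    (h : ∀ j < m, ε ∣ coeff n j f) (h' : ε ∣ coeff n m f - coeff n 0 d) (hm : m < n) :
    ∃ a b : TruncPoly O n, f = eps ε n * a + x O n ^ m * d + x O n ^ (m + 1) * b := by
  obtain ⟨a, b, hab⟩ := exists_eq_of_dvd_coeff (ε := ε) (m := m + 1) (f := f - x O n ^ m * d) (by
    intro j hj
    rw [map_sub]
    rcases Nat.lt_succ_iff_lt_or_eq.1 hj with hj | rfl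
    · rw [coeff_x_pow_mul_of_lt hj, sub_zero]
      exact h j hj
    · rwa [coeff_x_pow_mul' hm (zero_add _)])
  exact ⟨a, b, by linear_combination hab⟩

theorem exists_eq_x_mul (hn : 0 < n) {f : TruncPoly O n} (h : x O n ^ (n - 1) * f = 0) :
    ∃ g, f = x O n * g := by
  have h0 : coeff n 0 f = 0 := by
    rw [← coeff_x_pow_mul' (l := n - 1) (m := n - 1) (by omega) (by omega), h, map_zero]
  -- Taking `ε = 0` turns divisibility into vanishing of the constant coefficient.
  obtain ⟨a, b, hab⟩ := exists_eq_of_dvd_coeff (ε := (0 : O)) (m := 1) (f := f) (by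
    intro j hj
    obtain rfl : j = 0 := by omega
    rw [h0])
  refine ⟨b, ?_⟩
  rw [hab, eps, map_zero]
  ring

theorem x_pow_mul_eq_zero {f : TruncPoly O n} (hf : coeff n 0 f = 0) :
    x O n ^ (n - 1) * f = 0 := by
  refine ext_coeff fun j hj => ?_
  rw [map_zero]
  rcases Nat.lt_or_ge j (n - 1) with h | h
  · exact coeff_x_pow_mul_of_lt h _
  · rw [coeff_x_pow_mul' (j := 0) hj (by omega), hf]

end Coefficients

/-! ### Concrete models of `Z_i`, of `E_i` and of the complement in the middle term. -/

section Models

variable {O : Type u} [CommRing O] (ε : O) (n : ℕ)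

/-- The ideal `(ε, X^m)` of `O[X]/(X^n)`. -/
noncomputable def epsX (m : ℕ) : Submodule (TruncPoly O n) (TruncPoly O n) where
  carrier := {f | ∃ a b, f = eps ε n * a + x O n ^ m * b}
  add_mem' := by
    rintro _ _ ⟨a, b, rfl⟩ ⟨a', b', rfl⟩
    exact ⟨a + a', b + b', by ring⟩
  zero_mem' := ⟨0, 0, by ring⟩
  smul_mem' := by
    rintro c _ ⟨a, b, rfl⟩
    exact ⟨c * a, c * b, by rw [smul_eq_mul]; ring⟩

/-- The lattice of all `(f, h)` in `(ε, X^r) ⊕ (ε, X^(s+1))` with `ε f_r ≡ h_0` modulo `ε^2`. -/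
noncomputable def pairLattice (r s : ℕ) :
    Submodule (TruncPoly O n) (TruncPoly O n × TruncPoly O n) where
  carrier := {m | ∃ a b c d, m.1 = eps ε n * a + x O n ^ r * b + x O n ^ (r + 1) * c ∧
    m.2 = eps ε n * b + x O n ^ (s + 1) * d}
  add_mem' := by
    rintro m m' ⟨a, b, c, d, h1, h2⟩ ⟨a', b', c', d', h1', h2'⟩
    refine ⟨a + a', b + b', c + c', d + d', ?_, ?_⟩
    · rw [Prod.fst_add, h1, h1']; ring
    · rw [Prod.snd_add, h2, h2']; ring
  zero_mem' := ⟨0, 0, 0, 0, by simp, by simp⟩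
  smul_mem' := by
    rintro k m ⟨a, b, c, d, h1, h2⟩
    refine ⟨k * a, k * b, k * c, k * d, ?_, ?_⟩
    · rw [Prod.smul_fst, smul_eq_mul, h1]; ring
    · rw [Prod.smul_snd, smul_eq_mul, h2]; ring

/-- The lattice of all `(q, f, h)` in `(ε, X^s) ⊕ (ε, X^r) ⊕ (ε, X^(s+1))` with `ε q_s ≡ f_0` and
`ε f_r ≡ h_0` modulo `ε^2` (for `r` and `s` positive). -/
noncomputable def tripleLattice (r s : ℕ) :
    Submodule (TruncPoly O n) (TruncPoly O n × TruncPoly O n × TruncPoly O n) where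
  carrier := {m | ∃ a b c d e g, m.1 = eps ε n * a + x O n ^ s * b + x O n ^ (s + 1) * c ∧
    m.2.1 = eps ε n * b + x O n ^ r * d + x O n ^ (r + 1) * e ∧
    m.2.2 = eps ε n * d + x O n ^ (s + 1) * g}
  add_mem' := by
    rintro m m' ⟨a, b, c, d, e, g, h1, h2, h3⟩ ⟨a', b', c', d', e', g', h1', h2', h3'⟩
    refine ⟨a + a', b + b', c + c', d + d', e + e', g + g', ?_, ?_, ?_⟩
    · rw [Prod.fst_add, h1, h1']; ring
    · rw [Prod.snd_add, Prod.fst_add, h2, h2']; ring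
    · rw [Prod.snd_add, Prod.snd_add, h3, h3']; ring
  zero_mem' := ⟨0, 0, 0, 0, 0, 0, by simp, by simp, by simp⟩
  smul_mem' := by
    rintro k m ⟨a, b, c, d, e, g, h1, h2, h3⟩
    refine ⟨k * a, k * b, k * c, k * d, k * e, k * g, ?_, ?_, ?_⟩
    · rw [Prod.smul_fst, smul_eq_mul, h1]; ring
    · rw [Prod.smul_snd, Prod.smul_fst, smul_eq_mul, h2]; ring
    · rw [Prod.smul_snd, Prod.smul_snd, smul_eq_mul, h3]; ring

variable {ε n}

theorem heller_eq_epsX {i m : ℕ} (h : i + m = n) :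
    heller ε n i = epsX ε n m := by
  ext f
  rw [mem_heller]
  constructor
  · rintro ⟨g, hg⟩
    refine exists_eq_of_dvd_coeff fun j hj => ?_
    refine ⟨coeff n (j + i) g, ?_⟩
    rw [← coeff_x_pow_mul (j := j) (m := i) (by omega), hg, coeff_eps_mul]
  · rintro ⟨a, b, rfl⟩
    refine ⟨x O n ^ i * a, ?_⟩
    have h0 : x O n ^ i * x O n ^ m = 0 := by
      rw [← pow_add]
      exact x_pow_eq_zero n h.ge
    linear_combination b * h0

/-- Forgetting the second coordinate identifies `E_i` with a lattice of pairs. -/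
theorem nonempty_latticeE_equiv [IsDomain O] (hε : ε ≠ 0) {i r s : ℕ} (hi : 0 < i) (hin : i < n)
    (hr : i = r + 1) (hs : r + s + 2 = n) :
    Nonempty (latticeE hε hi hin ≃ₗ[TruncPoly O n] pairLattice ε n r s) := by
  have hni : n - i = s + 1 := by omega
  have hpow : x O n ^ (s + 1) * x O n ^ r = x O n ^ (n - 1) := by
    rw [← pow_add]; congr 1; omega
  have hz : x O n ^ (n - 1) * x O n ^ (s + 1) = 0 := by
    rw [← pow_add]; exact x_pow_eq_zero n (by omega)
  have hz' : x O n ^ (s + 1) * x O n ^ (r + 1) = 0 := by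
    rw [← pow_add]; exact x_pow_eq_zero n (by omega)
  have hmem : ∀ m : (TruncPoly O n × TruncPoly O n) × heller ε n i,
      m ∈ latticeE hε hi hin ↔ x O n ^ (s + 1) * m.1.1 - eps ε n * m.1.2 =
        (phi hε hi hin m.2 : TruncPoly O n) := by
    intro m
    rw [← hni, latticeE, LinearMap.mem_eqLocus, Subtype.ext_iff]
    rfl
  let F : latticeE hε hi hin →ₗ[TruncPoly O n] TruncPoly O n × TruncPoly O n :=
    ((LinearMap.fst _ _ _ ∘ₗ LinearMap.fst _ _ _).prod
      ((heller ε n i).subtype ∘ₗ LinearMap.snd _ _ _)) ∘ₗ (latticeE hε hi hin).subtype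
  have hF : ∀ m : latticeE hε hi hin, F m = (m.1.1.1, (m.1.2 : TruncPoly O n)) := fun _ => rfl
  have hphi : ∀ (h : heller ε n i) (b d : TruncPoly O n),
      (h : TruncPoly O n) = eps ε n * b + x O n ^ (s + 1) * d →
      (phi hε hi hin h : TruncPoly O n) = x O n ^ (n - 1) * b := by
    intro h b d hbd
    apply eps_mul_cancel hε
    rw [eps_mul_phi, hbd]
    linear_combination d * hz
  have hinj : Function.Injective F := by
    rintro ⟨⟨⟨f, g⟩, h⟩, hm⟩ ⟨⟨⟨f', g'⟩, h'⟩, hm'⟩ hFF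
    rw [hF, hF, Prod.mk.injEq] at hFF
    obtain ⟨rfl, h2⟩ : f = f' ∧ (h : TruncPoly O n) = h' := hFF
    obtain rfl := Subtype.ext h2
    rw [hmem] at hm hm'
    -- The equation determines `ε g` from `f` and `h`, so forgetting `g` loses nothing.
    have : g = g' := eps_mul_cancel hε (by linear_combination hm' - hm)
    rw [Subtype.mk.injEq, this]
  have hrange : LinearMap.range F = pairLattice ε n r s := by
    ext ⟨f, h⟩
    constructor
    · rintro ⟨⟨⟨⟨f, g⟩, h⟩, hm⟩, hFm⟩
      rw [hF, Prod.mk.injEq] at hFm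
      obtain ⟨rfl, rfl⟩ := hFm
      rw [hmem] at hm
      have hh := h.2
      replace hh := (heller_eq_epsX (m := s + 1) (by omega)).le hh
      obtain ⟨b, d, hbd⟩ := hh
      rw [hphi h b d hbd] at hm
      -- The pullback condition reads `X^(s+1) (f - X^r b) = ε g`, which is membership in `Z_{s+1} =
      -- (ε, X^(r+1))`. This is the origin of the gluing through the common element `b`.
      have h3 : f - x O n ^ r * b ∈ heller ε n (s + 1) := by
        rw [mem_heller]
        exact ⟨g, by linear_combination hm - b * hpow⟩
      rw [heller_eq_epsX (m := r + 1) (by omega)] at h3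
      obtain ⟨a, c, hac⟩ := h3
      exact ⟨a, b, c, d, by linear_combination hac, hbd⟩
    · rintro ⟨a, b, c, d, h1, h2⟩
      obtain rfl : f = _ := h1
      have hh : h ∈ heller ε n i := by
        rw [heller_eq_epsX (m := s + 1) (by omega)]
        exact ⟨b, d, h2⟩
      refine ⟨⟨((_, x O n ^ (s + 1) * a), ⟨h, hh⟩), ?_⟩, rfl⟩
      rw [hmem, hphi ⟨h, hh⟩ b d h2]
      change x O n ^ (s + 1) * (eps ε n * a + x O n ^ r * b + x O n ^ (r + 1) * c) -
        eps ε n * (x O n ^ (s + 1) * a) = x O n ^ (n - 1) * b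
      linear_combination b * hpow + c * hz'
  exact ⟨(LinearEquiv.ofInjective F hinj).trans (LinearEquiv.ofEq _ _ hrange)⟩

end Models

end TruncPoly

/-! ### Idempotent matrices over a local ring. -/

section IdempotentMatrices

theorem Matrix.eq_zero_of_isUnit_det_one_sub {R ι : Type*} [CommRing R] [Fintype ι] [DecidableEq ι]
    {M : Matrix ι ι R} (h : M * M = M) (hu : IsUnit (1 - M).det) : M = 0 := by
  have hM : IsUnit (1 - M) := (Matrix.isUnit_iff_isUnit_det _).2 hu
  have h0 : (1 - M) * M = 0 := by rw [sub_mul, one_mul, h, sub_self]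
  exact (hM.mul_right_eq_zero).1 h0

theorem Matrix.eq_one_of_isUnit_det {R ι : Type*} [CommRing R] [Fintype ι] [DecidableEq ι]
    {M : Matrix ι ι R} (h : M * M = M) (hu : IsUnit M.det) : M = 1 := by
  have hM : IsUnit M := (Matrix.isUnit_iff_isUnit_det _).2 hu
  have h0 : M * (M - 1) = 0 := by rw [mul_sub, mul_one, h, sub_self]
  exact sub_eq_zero.1 ((hM.mul_right_eq_zero).1 h0)

variable {O : Type*} [CommRing O] [IsLocalRing O]

theorem Matrix.eq_zero_or_one_of_residue {ι : Type*} [Fintype ι] [DecidableEq ι]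
    {M : Matrix ι ι O} (h : M * M = M)
    (h' : ((1 - M).map (IsLocalRing.residue O)).det ≠ 0 ∨
      (M.map (IsLocalRing.residue O)).det ≠ 0) : M = 0 ∨ M = 1 := by
  rcases h' with h' | h'
  · left
    refine Matrix.eq_zero_of_isUnit_det_one_sub h ?_
    rwa [← RingHom.mapMatrix_apply, ← RingHom.map_det, IsLocalRing.residue_ne_zero_iff_isUnit] at h'
  · right
    refine Matrix.eq_one_of_isUnit_det h ?_
    rwa [← RingHom.mapMatrix_apply, ← RingHom.map_det, IsLocalRing.residue_ne_zero_iff_isUnit] at h'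

/-- Over the residue field the common diagonal entry `a` satisfies `a^2 = a`, while `M` and `1 - M`
have determinants `a^2` and `(1 - a)^2`; one of them is nonzero. -/
theorem Matrix.idempotent_fin_two {M : Matrix (Fin 2) (Fin 2) O} (h : M * M = M)
    (hd : IsLocalRing.residue O (M 0 0) = IsLocalRing.residue O (M 1 1))
    (h01 : IsLocalRing.residue O (M 0 1) * IsLocalRing.residue O (M 1 0) = 0) :
    M = 0 ∨ M = 1 := by
  refine Matrix.eq_zero_or_one_of_residue h ?_
  have h1 := congrArg (IsLocalRing.residue O) (congrFun (congrFun h 0) 0)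
  rw [Matrix.mul_apply, Fin.sum_univ_two, map_add, map_mul, map_mul, h01, add_zero] at h1
  rw [Matrix.det_fin_two, Matrix.det_fin_two]
  simp only [Matrix.map_apply, Matrix.sub_apply, map_sub, Matrix.one_apply_eq, map_one,
    Matrix.one_apply_ne (show (0 : Fin 2) ≠ 1 by decide),
    Matrix.one_apply_ne (show (1 : Fin 2) ≠ 0 by decide), map_zero]
  rw [← hd, neg_mul_neg_of_zero h01]
  rcases eq_or_ne (IsLocalRing.residue O (M 0 0)) 0 with h0 | h0
  · left; rw [h0]; simp
  · right
    rw [mul_left_cancel₀ h0 (h1.trans (mul_one _).symm), h01]; simp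
where
  neg_mul_neg_of_zero {K : Type _} [CommRing K] {a b : K} (h : a * b = 0) :
      (0 - a) * (0 - b) = 0 := by linear_combination h

/-- The vanishing products kill both 3-cycles and all three transpositions in the determinant, so
only the diagonal term survives, as in size two. -/
theorem Matrix.idempotent_fin_three {M : Matrix (Fin 3) (Fin 3) O} (h : M * M = M)
    (hd : IsLocalRing.residue O (M 0 0) = IsLocalRing.residue O (M 1 1))
    (hd' : IsLocalRing.residue O (M 1 1) = IsLocalRing.residue O (M 2 2))
    (h01 : IsLocalRing.residue O (M 0 1) * IsLocalRing.residue O (M 1 0) = 0)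
    (h20 : IsLocalRing.residue O (M 2 0) = 0)
    (h12 : IsLocalRing.residue O (M 1 2) * IsLocalRing.residue O (M 2 1) = 0)
    (h02 : IsLocalRing.residue O (M 1 0) * IsLocalRing.residue O (M 2 1) = 0) :
    M = 0 ∨ M = 1 := by
  refine Matrix.eq_zero_or_one_of_residue h ?_
  have h1 := congrArg (IsLocalRing.residue O) (congrFun (congrFun h 0) 0)
  rw [Matrix.mul_apply, Fin.sum_univ_three, map_add, map_add, map_mul, map_mul, map_mul, h01, h20,
    add_zero, mul_zero, add_zero] at h1
  rw [Matrix.det_fin_three, Matrix.det_fin_three]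
  simp only [Matrix.map_apply, Matrix.sub_apply, map_sub, Matrix.one_apply_eq, map_one,
    Matrix.one_apply_ne (show (0 : Fin 3) ≠ 1 by decide),
    Matrix.one_apply_ne (show (1 : Fin 3) ≠ 0 by decide),
    Matrix.one_apply_ne (show (0 : Fin 3) ≠ 2 by decide),
    Matrix.one_apply_ne (show (2 : Fin 3) ≠ 0 by decide),
    Matrix.one_apply_ne (show (1 : Fin 3) ≠ 2 by decide),
    Matrix.one_apply_ne (show (2 : Fin 3) ≠ 1 by decide), map_zero]
  rw [← hd', ← hd, h20]
  generalize IsLocalRing.residue O (M 0 0) = a at *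
  generalize IsLocalRing.residue O (M 0 1) = b at *
  generalize IsLocalRing.residue O (M 0 2) = c at *
  generalize IsLocalRing.residue O (M 1 0) = d at *
  generalize IsLocalRing.residue O (M 1 2) = e at *
  generalize IsLocalRing.residue O (M 2 1) = g at *
  rcases eq_or_ne a 0 with rfl | h0
  · left
    refine ne_of_eq_of_ne (b := 1) ?_ one_ne_zero
    linear_combination -h12 - h01 - c * h02
  · right
    have ha : a = 1 := mul_left_cancel₀ h0 (h1.trans (mul_one _).symm)
    subst ha
    refine ne_of_eq_of_ne (b := 1) ?_ one_ne_zero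
    linear_combination -h12 - h01 + c * h02

end IdempotentMatrices

/-! ### The matrix of an endomorphism in leading coordinates. -/

namespace TruncPoly

variable {O : Type u} [CommRing O] {ε : O} {n : ℕ}

/-- Coordinates on `X^(n-1) M`, for a lattice `M` over `O[X]/(X^n)` such that `M ⊗ K` is free. -/
structure LeadingCoordinates (O : Type u) [CommRing O] (n : ℕ) (M : Type u) [AddCommGroup M]
    [Module O M] [Module (TruncPoly O n) M] (k : ℕ) where
  l : M →ₗ[O] (Fin k → O)
  t : Fin k → M
  l_t : ∀ β, l (t β) = Pi.single β 1
  l_eq_zero_iff : ∀ m, l m = 0 ↔ x O n ^ (n - 1) • m = 0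
  exists_smul_eq : ∀ m, l m = 0 → ∃ c : O, c ≠ 0 ∧ ∃ m', c • m = x O n • m'

namespace LeadingCoordinates

variable {M : Type u} [AddCommGroup M] [Module O M] [Module (TruncPoly O n) M]
  {k : ℕ} (c : LeadingCoordinates O n M k)

/-- The matrix of an endomorphism in leading coordinates. -/
noncomputable def mat (ρ : Module.End (TruncPoly O n) M) : Matrix (Fin k) (Fin k) O :=
  Matrix.of fun α β => c.l (ρ (c.t β)) α

theorem mat_apply (ρ : Module.End (TruncPoly O n) M) (α β : Fin k) :
    c.mat ρ α β = c.l (ρ (c.t β)) α := rfl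

theorem mat_one : c.mat 1 = 1 := by
  ext α β
  rw [mat_apply, Module.End.one_apply, c.l_t, Matrix.one_apply, Pi.single_apply]

theorem mat_sub (ρ σ : Module.End (TruncPoly O n) M) : c.mat (ρ - σ) = c.mat ρ - c.mat σ := by
  ext α β
  rw [mat_apply, LinearMap.sub_apply, map_sub]
  rfl

theorem nontrivial [Nontrivial O] [NeZero k] (c : LeadingCoordinates O n M k) : Nontrivial M := by
  refine ⟨c.t 0, 0, fun h => ?_⟩
  have := congrFun (c.l_t 0) 0
  rw [h, map_zero, Pi.single_eq_same] at this
  exact zero_ne_one this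

variable [IsScalarTower O (TruncPoly O n) M]

/-- The kernel of `l` is the kernel of `X^(n-1)`, which every endomorphism preserves; so `ρ`
descends to the quotient that `l` identifies with `O^k`. -/
theorem l_apply (ρ : Module.End (TruncPoly O n) M) (m : M) :
    c.l (ρ m) = (c.mat ρ).mulVec (c.l m) := by
  have h1 : c.l (m - ∑ β, c.l m β • c.t β) = 0 := by
    rw [map_sub, map_sum, sub_eq_zero]
    simp only [map_smul, c.l_t]
    ext α
    simp [Finset.sum_apply, Pi.single_apply]
  have h2 : c.l (ρ (m - ∑ β, c.l m β • c.t β)) = 0 := by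
    rw [c.l_eq_zero_iff] at h1 ⊢
    rw [← map_smul, h1, map_zero]
  rw [map_sub, map_sub, sub_eq_zero] at h2
  rw [h2, map_sum, map_sum]
  ext α
  rw [Finset.sum_apply, Matrix.mulVec, dotProduct]
  refine Finset.sum_congr rfl fun β _ => ?_
  rw [LinearMap.map_smul_of_tower, map_smul, Pi.smul_apply, smul_eq_mul, mat_apply, mul_comm]

theorem mat_mul (ρ σ : Module.End (TruncPoly O n) M) : c.mat (ρ * σ) = c.mat ρ * c.mat σ := by
  ext α β
  rw [mat_apply, Module.End.mul_apply, c.l_apply]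
  rfl

theorem mat_smul (a : O) (ρ : Module.End (TruncPoly O n) M) : c.mat (a • ρ) = a • c.mat ρ := by
  ext α β
  rw [mat_apply, LinearMap.smul_apply, map_smul]
  rfl

theorem eq_zero_of_mat_eq_zero [IsDomain O] [Module.IsTorsionFree O M]
    {ρ : Module.End (TruncPoly O n) M} (hρ : ρ * ρ = ρ) (h : c.mat ρ = 0) : ρ = 0 := by
  have h1 : ∀ m, c.l (ρ m) = 0 := fun m => by rw [c.l_apply, h, Matrix.zero_mulVec]
  have hρ' : ∀ m, ρ (ρ m) = ρ m := LinearMap.congr_fun hρ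
  -- Up to a nonzero scalar, `ρ m` equals `X • m'`, and applying the idempotent `ρ` replaces `m'` by
  -- `ρ m'`. Each such step lowers by one the power of `X` needed to kill the image of `ρ`.
  have key : ∀ j ≤ n, ∀ m, x O n ^ (n - j) • ρ m = 0 := by
    intro j
    induction j with
    | zero =>
      intro _ m
      rw [Nat.sub_zero, x_pow_eq_zero n le_rfl, zero_smul]
    | succ j ih =>
      intro hj m
      obtain ⟨a, ha, m', hm'⟩ := c.exists_smul_eq _ (h1 m)
      have h2 : a • ρ m = x O n • ρ m' := by
        rw [← LinearMap.map_smul ρ, ← hm', LinearMap.map_smul_of_tower, hρ']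
      have h3 : a • (x O n ^ (n - (j + 1)) • ρ m) = 0 := by
        rw [smul_comm, h2, smul_smul, ← pow_succ,
          show n - (j + 1) + 1 = n - j by omega, ih (by omega)]
      exact (smul_eq_zero.1 h3).resolve_left ha
  ext m
  simpa using key n le_rfl m

theorem isIndecomposableModule [IsDomain O] [Module.IsTorsionFree O M] [Nontrivial M]
    (h : ∀ ρ : Module.End (TruncPoly O n) M, c.mat ρ * c.mat ρ = c.mat ρ →
      c.mat ρ = 0 ∨ c.mat ρ = 1) : IsIndecomposableModule (TruncPoly O n) M := by
  refine isIndecomposableModule_of_idempotents fun ρ hρ => ?_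
  rcases h ρ (by rw [← c.mat_mul, hρ]) with h | h
  · exact Or.inl (c.eq_zero_of_mat_eq_zero hρ h)
  · right
    have h1 : (1 - ρ) * (1 - ρ) = 1 - ρ := by
      rw [mul_sub, sub_mul, sub_mul, hρ]
      simp
    have h2 : c.mat (1 - ρ) = 0 := by rw [c.mat_sub, c.mat_one, h, sub_self]
    exact (sub_eq_zero.1 (c.eq_zero_of_mat_eq_zero h1 h2)).symm

end LeadingCoordinates

section DivBy

variable [IsDomain O] {M : Type*} [AddCommGroup M] [Module O M]

/-- The quotient by `ε` of a linear form with values in the ideal `(ε)`. -/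
noncomputable def divBy (hε : ε ≠ 0) (g : M →ₗ[O] O) (h : ∀ m, ε ∣ g m) : M →ₗ[O] O where
  toFun m := (h m).choose
  map_add' a b := by
    apply mul_left_cancel₀ hε
    rw [mul_add, ← (h _).choose_spec, ← (h a).choose_spec, ← (h b).choose_spec, map_add]
  map_smul' r a := by
    apply mul_left_cancel₀ hε
    rw [← (h _).choose_spec, map_smul, RingHom.id_apply, smul_eq_mul, smul_eq_mul, mul_left_comm,
      ← (h a).choose_spec]

theorem mul_divBy (hε : ε ≠ 0) (g : M →ₗ[O] O) (h : ∀ m, ε ∣ g m) (m : M) :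
    ε * divBy hε g h m = g m := ((h m).choose_spec).symm

end DivBy

end TruncPoly

namespace TruncPoly

variable {O : Type u} [CommRing O] {ε : O} {n r s : ℕ}

theorem isTorsionFree_submodule {M : Type*} [AddCommGroup M] [Module O M]
    [Module (TruncPoly O n) M] [IsScalarTower O (TruncPoly O n) M] [Module.IsTorsionFree O M]
    (P : Submodule (TruncPoly O n) M) : Module.IsTorsionFree O P :=
  inferInstanceAs (Module.IsTorsionFree O (P.restrictScalars O))

theorem isTorsionFree_truncPoly : Module.IsTorsionFree O (TruncPoly O n) := by
  have : Module.Free O (TruncPoly O n) := (monic_X_pow n).free_adjoinRoot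
  infer_instance

theorem isALattice_truncPoly : IsALattice O (TruncPoly O n) (TruncPoly O n) :=
  ⟨(monic_X_pow n).finite_adjoinRoot, (monic_X_pow n).free_adjoinRoot⟩

theorem residue_eq_of_dvd [IsLocalRing O] (hε : ¬ IsUnit ε) {a b : O} (h : ε ∣ a - b) :
    IsLocalRing.residue O a = IsLocalRing.residue O b := by
  obtain ⟨c, hc⟩ := h
  rw [← sub_eq_zero, ← map_sub, hc, map_mul, (IsLocalRing.residue_eq_zero_iff ε).2 hε, zero_mul]

theorem residue_eq_zero_of_dvd [IsLocalRing O] (hε : ¬ IsUnit ε) {a : O} (h : ε ∣ a) :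
    IsLocalRing.residue O a = 0 := by
  rw [← map_zero (IsLocalRing.residue O)]
  exact residue_eq_of_dvd hε (by rwa [sub_zero])

/-! ### Membership in the glued lattices in terms of coefficients. -/

section Membership

theorem dvd_coeff_fst_of_mem {m : TruncPoly O n × TruncPoly O n} (hm : m ∈ pairLattice ε n r s)
    {j : ℕ} (hj : j < r) : ε ∣ coeff n j m.1 := by
  obtain ⟨a, b, c, d, h1, h2⟩ := hm
  rw [h1, map_add, map_add, coeff_eps_mul, coeff_x_pow_mul_of_lt hj,
    coeff_x_pow_mul_of_lt (by omega), add_zero, add_zero]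
  exact dvd_mul_right _ _

theorem exists_coeff_zero_snd_of_mem (hrn : r < n) {m : TruncPoly O n × TruncPoly O n}
    (hm : m ∈ pairLattice ε n r s) :
    ∃ b, coeff n 0 m.2 = ε * b ∧ ε ∣ coeff n r m.1 - b := by
  obtain ⟨a, b, c, d, h1, h2⟩ := hm
  refine ⟨coeff n 0 b, ?_, coeff n r a, ?_⟩
  · rw [h2, map_add, coeff_eps_mul, coeff_x_pow_mul_of_lt (by omega), add_zero]
  · rw [h1, map_add, map_add, coeff_eps_mul, coeff_x_pow_mul' hrn (zero_add _),
      coeff_x_pow_mul_of_lt (by omega)]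
    ring

theorem mem_pairLattice_of_dvd (hrn : r < n) {m : TruncPoly O n × TruncPoly O n} {b : O}
    (h1 : ∀ j < r, ε ∣ coeff n j m.1) (h2 : ∀ j < s + 1, ε ∣ coeff n j m.2)
    (h3 : coeff n 0 m.2 = ε * b) (h4 : ε ∣ coeff n r m.1 - b) [IsDomain O] (hε : ε ≠ 0) :
    m ∈ pairLattice ε n r s := by
  obtain ⟨b', d, hd⟩ := exists_eq_of_dvd_coeff h2
  have hb : coeff n 0 b' = b := by
    apply mul_left_cancel₀ hε
    rw [← h3, hd, map_add, coeff_eps_mul, coeff_x_pow_mul_of_lt (by omega), add_zero]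
  obtain ⟨a, c, hac⟩ := exists_eq_of_dvd_coeff_sub (d := b') h1 (by rwa [hb]) hrn
  exact ⟨a, b', c, d, hac, hd⟩

theorem dvd_coeff_snd_of_mem {m : TruncPoly O n × TruncPoly O n} (hm : m ∈ pairLattice ε n r s)
    {j : ℕ} (hj : j < s + 1) : ε ∣ coeff n j m.2 := by
  obtain ⟨a, b, c, d, h1, h2⟩ := hm
  rw [h2]
  exact dvd_coeff_of_lt hj _ _

theorem snd_mem_pairLattice {m : TruncPoly O n × TruncPoly O n × TruncPoly O n}
    (hm : m ∈ tripleLattice ε n r s) : m.2 ∈ pairLattice ε n r s := by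
  obtain ⟨a, b, c, d, e, g, h1, h2, h3⟩ := hm
  exact ⟨b, d, e, g, h2, h3⟩

theorem dvd_coeff_fst_of_mem_tripleLattice {m : TruncPoly O n × TruncPoly O n × TruncPoly O n}
    (hm : m ∈ tripleLattice ε n r s) {j : ℕ} (hj : j < s) : ε ∣ coeff n j m.1 := by
  obtain ⟨a, b, c, d, e, g, h1, h2, h3⟩ := hm
  rw [h1, map_add, map_add, coeff_eps_mul, coeff_x_pow_mul_of_lt hj,
    coeff_x_pow_mul_of_lt (by omega), add_zero, add_zero]
  exact dvd_mul_right _ _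

theorem exists_coeff_zero_of_mem_tripleLattice (hr : 1 ≤ r) (hsn : s < n)
    {m : TruncPoly O n × TruncPoly O n × TruncPoly O n} (hm : m ∈ tripleLattice ε n r s) :
    ∃ b, coeff n 0 m.2.1 = ε * b ∧ ε ∣ coeff n s m.1 - b := by
  obtain ⟨a, b, c, d, e, g, h1, h2, h3⟩ := hm
  refine ⟨coeff n 0 b, ?_, coeff n s a, ?_⟩
  · rw [h2, map_add, map_add, coeff_eps_mul, coeff_x_pow_mul_of_lt (by omega),
      coeff_x_pow_mul_of_lt (by omega), add_zero, add_zero]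
  · rw [h1, map_add, map_add, coeff_eps_mul, coeff_x_pow_mul' hsn (zero_add _),
      coeff_x_pow_mul_of_lt (by omega)]
    ring

theorem mem_tripleLattice_of_dvd (hr : 1 ≤ r) (hsn : s < n) [IsDomain O] (hε : ε ≠ 0)
    {m : TruncPoly O n × TruncPoly O n × TruncPoly O n} {b : O}
    (h : m.2 ∈ pairLattice ε n r s) (h1 : ∀ j < s, ε ∣ coeff n j m.1)
    (h2 : coeff n 0 m.2.1 = ε * b) (h3 : ε ∣ coeff n s m.1 - b) : m ∈ tripleLattice ε n r s := by
  obtain ⟨a, b', c, d, h5, h6⟩ := h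
  have hb : coeff n 0 a = b := by
    apply mul_left_cancel₀ hε
    rw [← h2, h5, map_add, map_add, coeff_eps_mul, coeff_x_pow_mul_of_lt (by omega),
      coeff_x_pow_mul_of_lt (by omega), add_zero, add_zero]
  obtain ⟨a', c', hac⟩ := exists_eq_of_dvd_coeff_sub (d := a) h1 (by rwa [hb]) hsn
  exact ⟨a', a, c', b', c, d, hac, h5, h6⟩

end Membership

/-! ### Endomorphisms of the lattice of pairs, with generators `v, u, y, w`. -/

section Pair

theorem dvd_coeff_zero_fst (hr : 1 ≤ r) (m : pairLattice ε n r s) :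
    ε ∣ (coeff n 0 ∘ₗ ((LinearMap.fst _ _ _ ∘ₗ
      (pairLattice ε n r s).subtype).restrictScalars O)) m :=
  dvd_coeff_fst_of_mem m.2 hr

theorem dvd_coeff_zero_snd (m : pairLattice ε n r s) :
    ε ∣ (coeff n 0 ∘ₗ ((LinearMap.snd _ _ _ ∘ₗ
      (pairLattice ε n r s).subtype).restrictScalars O)) m :=
  dvd_coeff_snd_of_mem m.2 (Nat.succ_pos s)

variable (ε n r s) in
/-- The element `(ε, 0)`. -/
noncomputable def pairV : pairLattice ε n r s := ⟨(eps ε n, 0), 1, 0, 0, 0, by simp, by simp⟩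

variable (ε n r s) in
/-- The element `(X^r, ε)`. -/
noncomputable def pairU : pairLattice ε n r s :=
  ⟨(x O n ^ r, eps ε n), 0, 1, 0, 0, by simp, by simp⟩

variable (ε n r s) in
/-- The element `(X^(r+1), 0)`. -/
noncomputable def pairY : pairLattice ε n r s :=
  ⟨(x O n ^ (r + 1), 0), 0, 0, 1, 0, by simp, by simp⟩

variable (ε n r s) in
/-- The element `(0, X^(s+1))`. -/
noncomputable def pairW : pairLattice ε n r s :=
  ⟨(0, x O n ^ (s + 1)), 0, 0, 0, 1, by simp, by simp⟩

theorem eps_smul_pairY : eps ε n • pairY ε n r s = x O n ^ (r + 1) • pairV ε n r s := by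
  apply Subtype.ext
  simp only [pairY, pairV, Submodule.coe_smul, Prod.smul_mk, smul_eq_mul, mul_zero, Prod.mk.injEq,
    and_true]
  ring

theorem eps_smul_pairW :
    eps ε n • pairW ε n r s = x O n ^ (s + 1) • pairU ε n r s - x O n ^ s • pairY ε n r s := by
  apply Subtype.ext
  simp only [pairW, pairU, pairY, Submodule.coe_smul, Submodule.coe_sub, Prod.smul_mk, smul_eq_mul,
    mul_zero, Prod.mk_sub_mk, Prod.mk.injEq]
  exact ⟨by ring, by ring⟩

theorem eps_smul_map_pairY {N : Type*} [AddCommGroup N] [Module (TruncPoly O n) N]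
    (ρ : pairLattice ε n r s →ₗ[TruncPoly O n] N) :
    eps ε n • ρ (pairY ε n r s) = x O n ^ (r + 1) • ρ (pairV ε n r s) := by
  rw [← map_smul, eps_smul_pairY, map_smul]

theorem eps_smul_map_pairW {N : Type*} [AddCommGroup N] [Module (TruncPoly O n) N]
    (ρ : pairLattice ε n r s →ₗ[TruncPoly O n] N) : eps ε n • ρ (pairW ε n r s) =
      x O n ^ (s + 1) • ρ (pairU ε n r s) - x O n ^ s • ρ (pairY ε n r s) := by
  rw [← map_smul, eps_smul_pairW, map_sub, map_smul, map_smul]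

variable [IsDomain O]

/-- The constant coefficients of a pair, divided by `ε`. -/
noncomputable def pairForm (hε : ε ≠ 0) (hr : 1 ≤ r) : pairLattice ε n r s →ₗ[O] Fin 2 → O :=
  LinearMap.pi ![divBy hε _ (dvd_coeff_zero_fst hr), divBy hε _ dvd_coeff_zero_snd]

theorem mul_pairForm_zero (hε : ε ≠ 0) (hr : 1 ≤ r) (m : pairLattice ε n r s) :
    ε * pairForm hε hr m 0 = coeff n 0 m.1.1 :=
  mul_divBy hε _ (dvd_coeff_zero_fst hr) m

theorem mul_pairForm_one (hε : ε ≠ 0) (hr : 1 ≤ r) (m : pairLattice ε n r s) :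
    ε * pairForm hε hr m 1 = coeff n 0 m.1.2 :=
  mul_divBy hε _ dvd_coeff_zero_snd m

theorem dvd_coeff_sub_pairForm (hε : ε ≠ 0) (hr : 1 ≤ r) (hrn : r < n)
    (m : pairLattice ε n r s) : ε ∣ coeff n r m.1.1 - pairForm hε hr m 1 := by
  obtain ⟨b, h1, h2⟩ := exists_coeff_zero_snd_of_mem hrn m.2
  rw [← mul_pairForm_one hε hr] at h1
  rwa [mul_left_cancel₀ hε h1]

/-- Leading coordinates on the lattice of pairs. -/
noncomputable def pairCoords (hε : ε ≠ 0) (hr : 1 ≤ r) (hn : 0 < n) :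
    LeadingCoordinates O n (pairLattice ε n r s) 2 where
  l := pairForm hε hr
  t := ![pairV ε n r s, pairU ε n r s]
  l_t := by
    intro β
    ext α
    apply mul_left_cancel₀ hε
    fin_cases β <;> fin_cases α <;>
      simp [mul_pairForm_zero, mul_pairForm_one, pairV, pairU, coeff_eps_zero hn]
    simpa using coeff_x_pow_mul_of_lt (n := n) (j := 0) (m := r) hr (1 : TruncPoly O n)
  l_eq_zero_iff := by
    intro m
    have h0 := mul_pairForm_zero hε hr m
    have h1 := mul_pairForm_one hε hr m
    constructor
    · intro h
      rw [h, Pi.zero_apply, mul_zero] at h0 h1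
      apply Subtype.ext
      exact Prod.ext (x_pow_mul_eq_zero h0.symm) (x_pow_mul_eq_zero h1.symm)
    · intro h
      have e1 : x O n ^ (n - 1) * m.1.1 = 0 := congrArg (fun m => m.1.1) h
      have e2 : x O n ^ (n - 1) * m.1.2 = 0 := congrArg (fun m => m.1.2) h
      rw [← coeff_x_pow_mul' (l := n - 1) (m := n - 1) (by omega) (by omega), e1, map_zero] at h0
      rw [← coeff_x_pow_mul' (l := n - 1) (m := n - 1) (by omega) (by omega), e2, map_zero] at h1
      ext α
      fin_cases α
      · exact (mul_eq_zero.1 h0).resolve_left hε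
      · exact (mul_eq_zero.1 h1).resolve_left hε
  exists_smul_eq := by
    intro m h
    have h0 := mul_pairForm_zero hε hr m
    have h1 := mul_pairForm_one hε hr m
    rw [h, Pi.zero_apply, mul_zero] at h0 h1
    obtain ⟨f, hf⟩ := exists_eq_x_mul hn (x_pow_mul_eq_zero h0.symm)
    obtain ⟨g, hg⟩ := exists_eq_x_mul hn (x_pow_mul_eq_zero h1.symm)
    -- The factor `ε^2` suffices because `ε^2 (A ⊕ A)` lies in the lattice; the witness `a` cancels
    -- the gluing term `X^r b`.
    refine ⟨ε ^ 2, pow_ne_zero 2 hε, ⟨(eps ε n ^ 2 * f, eps ε n ^ 2 * g),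
      eps ε n * f - x O n ^ r * g, eps ε n * g, 0, 0, by ring, by ring⟩, ?_⟩
    apply Subtype.ext
    rw [← eps_mul_eq_smul (n := n), eps, map_pow]
    refine Prod.ext ?_ ?_
    · change eps ε n ^ 2 * m.1.1 = x O n * (eps ε n ^ 2 * f)
      rw [hf]; ring
    · change eps ε n ^ 2 * m.1.2 = x O n * (eps ε n ^ 2 * g)
      rw [hg]; ring


theorem coeff_map_pairY_fst (hε : ε ≠ 0) (hr : 1 ≤ r) (hn : r + s + 2 = n)
    (ρ : Module.End (TruncPoly O n) (pairLattice ε n r s)) :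
    coeff n (r + 1) (ρ (pairY ε n r s)).1.1 = pairForm hε hr (ρ (pairV ε n r s)) 0 := by
  have h := congrArg (fun m => coeff n (r + 1) m.1.1) (eps_smul_map_pairY ρ)
  simp only [Submodule.coe_smul, Prod.smul_fst, smul_eq_mul, coeff_eps_mul] at h
  rw [coeff_x_pow_mul' (by omega) (zero_add _), ← mul_pairForm_zero hε hr] at h
  exact mul_left_cancel₀ hε h

/-- The coefficient of `X^(n-1)` in `ε w = X^(s+1) u - X^s y` compares coefficient `r` of `ρ u` with
coefficient `r + 1` of `ρ y`. Gluing and `coeff_map_pairY_fst` turn these into the two diagonal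
entries. -/
theorem dvd_pairForm_sub (hε : ε ≠ 0) (hr : 1 ≤ r) (hn : r + s + 2 = n)
    (ρ : Module.End (TruncPoly O n) (pairLattice ε n r s)) :
    ε ∣ pairForm hε hr (ρ (pairV ε n r s)) 0 - pairForm hε hr (ρ (pairU ε n r s)) 1 := by
  have h1 := dvd_coeff_sub_pairForm hε hr (by omega) (ρ (pairU ε n r s))
  have h2 := congrArg (fun m => coeff n (n - 1) m.1.1) (eps_smul_map_pairW ρ)
  simp only [Submodule.coe_smul, Submodule.coe_sub, Prod.smul_fst, Prod.fst_sub, smul_eq_mul,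
    coeff_eps_mul, map_sub] at h2
  rw [coeff_x_pow_mul' (j := r) (by omega) (by omega),
    coeff_x_pow_mul' (j := r + 1) (by omega) (by omega), coeff_map_pairY_fst hε hr hn] at h2
  obtain ⟨c, hc⟩ := h1
  exact ⟨c - coeff n (n - 1) (ρ (pairW ε n r s)).1.1, by linear_combination hc + h2⟩

/-- The relation `ε y = X^(r+1) v` is read at `X^(2r+1)`, a nonzero power exactly when `r ≤ s`; it
makes coefficient `r` of `ρ v` divisible by `ε`, and gluing links that coefficient to the matrix
entry. -/
theorem dvd_pairForm_map_pairV_one (hε : ε ≠ 0) (hr : 1 ≤ r) (hn : r + s + 2 = n)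
    (ρ : Module.End (TruncPoly O n) (pairLattice ε n r s))
    (hrs : r ≤ s) : ε ∣ pairForm hε hr (ρ (pairV ε n r s)) 1 := by
  obtain ⟨c, hc⟩ := dvd_coeff_sub_pairForm hε hr (by omega) (ρ (pairV ε n r s))
  have h := congrArg (fun m => coeff n (2 * r + 1) m.1.1) (eps_smul_map_pairY ρ)
  simp only [Submodule.coe_smul, Prod.smul_fst, smul_eq_mul, coeff_eps_mul] at h
  rw [ coeff_x_pow_mul' (j := r) (by omega) (by omega)] at h
  exact ⟨coeff n (2 * r + 1) (ρ (pairY ε n r s)).1.1 - c, by linear_combination -h - hc⟩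

/-- The relation for `w` at `X^(s+1)` shows that the entry equals coefficient `s + 1` of `ρ w`. For
`s + 1 < r` this is divisible by `ε` by membership; for `s + 1 = r` gluing links it to the second
coordinate of `ρ w`, which is zero. -/
theorem dvd_pairForm_map_pairU_zero (hε : ε ≠ 0) (hr : 1 ≤ r) (hn : r + s + 2 = n)
    (ρ : Module.End (TruncPoly O n) (pairLattice ε n r s))
    (hs : 1 ≤ s) (hsr : s < r) :
    ε ∣ pairForm hε hr (ρ (pairU ε n r s)) 0 := by
  have h1 := congrArg (fun m => coeff n 1 m.1.1) (eps_smul_map_pairY ρ)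
  simp only [Submodule.coe_smul, Prod.smul_fst, smul_eq_mul, coeff_eps_mul] at h1
  rw [ coeff_x_pow_mul_of_lt (by omega)] at h1
  have h1' := (mul_eq_zero.1 h1).resolve_left hε
  have h2 := congrArg (fun m => coeff n (s + 1) m.1.1) (eps_smul_map_pairW ρ)
  simp only [Submodule.coe_smul, Submodule.coe_sub, Prod.smul_fst, Prod.fst_sub, smul_eq_mul,
    coeff_eps_mul, map_sub] at h2
  rw [coeff_x_pow_mul' (by omega) (zero_add _), coeff_x_pow_mul' (j := 1) (by omega) (by omega),
    h1', sub_zero, ← mul_pairForm_zero hε hr] at h2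
  rw [← mul_left_cancel₀ hε h2]
  rcases (show s + 1 < r ∨ s + 1 = r by omega) with h | h
  · exact dvd_coeff_fst_of_mem (ρ (pairW ε n r s)).2 h
  · have h3 := dvd_coeff_sub_pairForm hε hr (by omega) (ρ (pairW ε n r s))
    have h4 : pairForm hε hr (ρ (pairW ε n r s)) 1 = 0 := by
      have h5 := congrArg (fun m => coeff n 0 m.1.2) (eps_smul_map_pairW ρ)
      simp only [Submodule.coe_smul, Submodule.coe_sub, Prod.smul_snd, Prod.snd_sub, smul_eq_mul,
        coeff_eps_mul, map_sub] at h5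
      rw [coeff_x_pow_mul_of_lt (by omega), coeff_x_pow_mul_of_lt (by omega), sub_zero,
        ← mul_pairForm_one hε hr] at h5
      simpa [hε] using h5
    rwa [h4, sub_zero, ← congrArg (coeff n) h] at h3

variable [IsLocalRing O]

theorem pairCoords_mat_residue (hε : ε ≠ 0) (hu : ¬ IsUnit ε) (hr : 1 ≤ r) (hs : 1 ≤ s)
    (hn : r + s + 2 = n) (ρ : Module.End (TruncPoly O n) (pairLattice ε n r s)) :
    let M := (pairCoords hε hr (by omega) : LeadingCoordinates O n (pairLattice ε n r s) 2).mat ρ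
    IsLocalRing.residue O (M 0 0) = IsLocalRing.residue O (M 1 1) ∧
      IsLocalRing.residue O (M 0 1) * IsLocalRing.residue O (M 1 0) = 0 := by
  intro M
  refine ⟨residue_eq_of_dvd hu (dvd_pairForm_sub hε hr hn ρ), ?_⟩
  rcases le_or_gt r s with h | h
  · rw [show IsLocalRing.residue O (M 1 0) = 0 from
      residue_eq_zero_of_dvd hu (dvd_pairForm_map_pairV_one hε hr hn ρ h), mul_zero]
  · rw [show IsLocalRing.residue O (M 0 1) = 0 from
      residue_eq_zero_of_dvd hu (dvd_pairForm_map_pairU_zero hε hr hn ρ hs h), zero_mul]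

theorem isIndecomposableModule_pairLattice (hε : ε ≠ 0) (hu : ¬ IsUnit ε) (hr : 1 ≤ r) (hs : 1 ≤ s)
    (hn : r + s + 2 = n) : IsIndecomposableModule (TruncPoly O n) (pairLattice ε n r s) := by
  have := isTorsionFree_truncPoly (O := O) (n := n)
  have := isTorsionFree_submodule (O := O) (pairLattice ε n r s)
  let c : LeadingCoordinates O n (pairLattice ε n r s) 2 := pairCoords hε hr (by omega)
  have : Nontrivial (pairLattice ε n r s) := c.nontrivial
  refine c.isIndecomposableModule fun ρ h => ?_
  obtain ⟨h1, h2⟩ := pairCoords_mat_residue hε hu hr hs hn ρ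
  exact Matrix.idempotent_fin_two h h1 h2

/-- The matrix of a radical endomorphism of the lattice of pairs has no unit on its diagonal. -/
theorem not_isUnit_of_mem_jacobson (hε : ε ≠ 0) (hu : ¬ IsUnit ε) (hr : 1 ≤ r) (hs : 1 ≤ s)
    (hn : r + s + 2 = n) (ρ : Module.End (TruncPoly O n) (pairLattice ε n r s))
    (hρ : ρ ∈ Ring.jacobson (Module.End (TruncPoly O n) (pairLattice ε n r s))) :
    ¬ IsUnit (pairForm hε hr (ρ (pairV ε n r s)) 0) := by
  rintro ⟨a, ha⟩
  let c : LeadingCoordinates O n (pairLattice ε n r s) 2 := pairCoords hε hr (by omega)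
  -- Were the entry a unit `a`, then `1 - a⁻¹ρ` would be invertible, although its matrix has zero
  -- diagonal and zero determinant over the residue field.
  have h1 := isUnit_one_sub_of_mem_jacobson hρ ((↑a⁻¹ : O) • 1)
    (isIndecomposableModule_pairLattice hε hu hr hs hn).mul_eq_one_comm
  have h2 : IsUnit (c.mat (1 - (↑a⁻¹ : O) • 1 * ρ)) := by
    obtain ⟨w, hw⟩ := h1
    rw [← hw]
    exact ⟨⟨c.mat ↑w, c.mat ↑w⁻¹, by rw [← c.mat_mul, w.mul_inv, c.mat_one],
      by rw [← c.mat_mul, w.inv_mul, c.mat_one]⟩, rfl⟩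
  rw [Matrix.isUnit_iff_isUnit_det, ← IsLocalRing.residue_ne_zero_iff_isUnit,
    RingHom.map_det, Matrix.det_fin_two] at h2
  obtain ⟨h3, h4⟩ := pairCoords_mat_residue hε hu hr hs hn (1 - (↑a⁻¹ : O) • 1 * ρ)
  apply h2
  simp only [RingHom.mapMatrix_apply, Matrix.map_apply]
  rw [h4, ← h3]
  have h5 : c.mat (1 - (↑a⁻¹ : O) • 1 * ρ) 0 0 = 0 := by
    rw [c.mat_sub, c.mat_one, smul_mul_assoc, one_mul, c.mat_smul, Matrix.sub_apply,
      Matrix.smul_apply, Matrix.one_apply_eq, smul_eq_mul]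
    change 1 - ↑a⁻¹ * pairForm hε hr (ρ (pairV ε n r s)) 0 = 0
    rw [← ha, a.inv_mul, sub_self]
  have h6 : IsLocalRing.residue O (c.mat (1 - (↑a⁻¹ : O) • 1 * ρ) 0 0) = 0 := by
    rw [h5, map_zero]
  rw [sub_zero]
  exact mul_eq_zero_of_left h6 _

end Pair

end TruncPoly

namespace TruncPoly

variable {O : Type u} [CommRing O] {ε : O} {n r s : ℕ}

/-! ### Endomorphisms of the lattice of triples. -/

section Triple

theorem dvd_coeff_zero_triple_fst (hs : 1 ≤ s) (m : tripleLattice ε n r s) :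
    ε ∣ (coeff n 0 ∘ₗ ((LinearMap.fst _ _ _ ∘ₗ
      (tripleLattice ε n r s).subtype).restrictScalars O)) m :=
  dvd_coeff_fst_of_mem_tripleLattice m.2 hs

variable (ε n r s) in
/-- The projection `(q, f, h) ↦ (f, h)`. -/
noncomputable def tripleToPair : tripleLattice ε n r s →ₗ[TruncPoly O n] pairLattice ε n r s :=
  ((LinearMap.snd _ _ _).comp (tripleLattice ε n r s).subtype).codRestrict _
    fun m => snd_mem_pairLattice m.2

variable (ε n r s) in
/-- The element `(ε, 0, 0)`. -/
noncomputable def tripleV : tripleLattice ε n r s :=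
  ⟨(eps ε n, 0, 0), 1, 0, 0, 0, 0, 0, by simp, by simp, by simp⟩

variable (ε n r s) in
/-- The element `(X^s, ε, 0)`. -/
noncomputable def tripleU : tripleLattice ε n r s :=
  ⟨(x O n ^ s, eps ε n, 0), 0, 1, 0, 0, 0, 0, by simp, by simp, by simp⟩

variable (ε n r s) in
/-- The element `(0, X^r, ε)`. -/
noncomputable def tripleT : tripleLattice ε n r s :=
  ⟨(0, x O n ^ r, eps ε n), 0, 0, 0, 1, 0, 0, by simp, by simp, by simp⟩

variable (ε n r s) in
/-- The element `(X^(s+1), 0, 0)`. -/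
noncomputable def tripleX : tripleLattice ε n r s :=
  ⟨(x O n ^ (s + 1), 0, 0), 0, 0, 1, 0, 0, 0, by simp, by simp, by simp⟩

variable (ε n r s) in
/-- The element `(0, X^(r+1), 0)`. -/
noncomputable def tripleY : tripleLattice ε n r s :=
  ⟨(0, x O n ^ (r + 1), 0), 0, 0, 0, 0, 1, 0, by simp, by simp, by simp⟩

variable (ε n r s) in
/-- The element `(0, 0, X^(s+1))`. -/
noncomputable def tripleW : tripleLattice ε n r s :=
  ⟨(0, 0, x O n ^ (s + 1)), 0, 0, 0, 0, 0, 1, by simp, by simp, by simp⟩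

variable (ρ : Module.End (TruncPoly O n) (tripleLattice ε n r s))

theorem eps_smul_map_tripleX :
    eps ε n • ρ (tripleX ε n r s) = x O n ^ (s + 1) • ρ (tripleV ε n r s) := by
  rw [← LinearMap.map_smul ρ, ← LinearMap.map_smul ρ]
  congr 1
  apply Subtype.ext
  simp only [tripleX, tripleV, Submodule.coe_smul, Prod.smul_mk, smul_eq_mul, mul_zero,
    Prod.mk.injEq, and_true]
  ring

theorem eps_smul_map_tripleY : eps ε n • ρ (tripleY ε n r s) =
    x O n ^ (r + 1) • ρ (tripleU ε n r s) - x O n ^ r • ρ (tripleX ε n r s) := by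
  rw [← LinearMap.map_smul ρ, ← LinearMap.map_smul ρ, ← LinearMap.map_smul ρ, ← map_sub]
  congr 1
  apply Subtype.ext
  simp only [tripleX, tripleU, tripleY, Submodule.coe_smul, Submodule.coe_sub, Prod.smul_mk,
    smul_eq_mul, mul_zero, Prod.mk_sub_mk, Prod.mk.injEq]
  exact ⟨by ring, by ring, by ring⟩

theorem eps_smul_map_tripleW : eps ε n • ρ (tripleW ε n r s) =
    x O n ^ (s + 1) • ρ (tripleT ε n r s) - x O n ^ s • ρ (tripleY ε n r s) := by
  rw [← LinearMap.map_smul ρ, ← LinearMap.map_smul ρ, ← LinearMap.map_smul ρ, ← map_sub]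
  congr 1
  apply Subtype.ext
  simp only [tripleW, tripleT, tripleY, Submodule.coe_smul, Submodule.coe_sub, Prod.smul_mk,
    smul_eq_mul, mul_zero, Prod.mk_sub_mk, Prod.mk.injEq]
  exact ⟨by ring, by ring, by ring⟩

variable [IsDomain O]

/-- The constant coefficients of a triple, divided by `ε`. -/
noncomputable def tripleForm (hε : ε ≠ 0) (hr : 1 ≤ r) (hs : 1 ≤ s) :
    tripleLattice ε n r s →ₗ[O] Fin 3 → O :=
  LinearMap.pi ![divBy hε _ (dvd_coeff_zero_triple_fst hs),
    LinearMap.proj 0 ∘ₗ pairForm hε hr ∘ₗ (tripleToPair ε n r s).restrictScalars O,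
    LinearMap.proj 1 ∘ₗ pairForm hε hr ∘ₗ (tripleToPair ε n r s).restrictScalars O]

variable (hε : ε ≠ 0) (hr : 1 ≤ r) (hs : 1 ≤ s)

theorem mul_tripleForm_zero (m : tripleLattice ε n r s) :
    ε * tripleForm hε hr hs m 0 = coeff n 0 m.1.1 :=
  mul_divBy hε _ (dvd_coeff_zero_triple_fst hs) m

theorem mul_tripleForm_one (m : tripleLattice ε n r s) :
    ε * tripleForm hε hr hs m 1 = coeff n 0 m.1.2.1 :=
  mul_pairForm_zero hε hr (tripleToPair ε n r s m)

theorem mul_tripleForm_two (m : tripleLattice ε n r s) :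
    ε * tripleForm hε hr hs m 2 = coeff n 0 m.1.2.2 :=
  mul_pairForm_one hε hr (tripleToPair ε n r s m)

theorem dvd_coeff_sub_tripleForm_two (hrn : r < n) (m : tripleLattice ε n r s) :
    ε ∣ coeff n r m.1.2.1 - tripleForm hε hr hs m 2 :=
  dvd_coeff_sub_pairForm hε hr hrn (tripleToPair ε n r s m)

theorem dvd_coeff_sub_tripleForm_one (hsn : s < n) (m : tripleLattice ε n r s) :
    ε ∣ coeff n s m.1.1 - tripleForm hε hr hs m 1 := by
  obtain ⟨b, h1, h2⟩ := exists_coeff_zero_of_mem_tripleLattice hr hsn m.2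
  rw [← mul_tripleForm_one hε hr hs] at h1
  rwa [mul_left_cancel₀ hε h1]

/-- Leading coordinates on the lattice of triples. -/
noncomputable def tripleCoords (hn : 0 < n) :
    LeadingCoordinates O n (tripleLattice ε n r s) 3 where
  l := tripleForm hε hr hs
  t := ![tripleV ε n r s, tripleU ε n r s, tripleT ε n r s]
  l_t := by
    have h1 : ∀ m, 1 ≤ m → coeff n 0 (x O n ^ m) = 0 := fun m hm => by
      simpa using coeff_x_pow_mul_of_lt (n := n) (j := 0) (m := m) hm (1 : TruncPoly O n)
    intro β
    ext α
    apply mul_left_cancel₀ hε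
    fin_cases β <;> fin_cases α <;>
      simp [mul_tripleForm_zero, mul_tripleForm_one, mul_tripleForm_two, tripleV, tripleU, tripleT,
        coeff_eps_zero hn, h1 _ hr, h1 _ hs]
  l_eq_zero_iff := by
    intro m
    have h0 := mul_tripleForm_zero hε hr hs m
    have h1 := mul_tripleForm_one hε hr hs m
    have h2 := mul_tripleForm_two hε hr hs m
    constructor
    · intro h
      rw [h, Pi.zero_apply, mul_zero] at h0 h1 h2
      apply Subtype.ext
      exact Prod.ext (x_pow_mul_eq_zero h0.symm)
        (Prod.ext (x_pow_mul_eq_zero h1.symm) (x_pow_mul_eq_zero h2.symm))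
    · intro h
      have e0 : x O n ^ (n - 1) * m.1.1 = 0 := congrArg (fun m => m.1.1) h
      have e1 : x O n ^ (n - 1) * m.1.2.1 = 0 := congrArg (fun m => m.1.2.1) h
      have e2 : x O n ^ (n - 1) * m.1.2.2 = 0 := congrArg (fun m => m.1.2.2) h
      rw [← coeff_x_pow_mul' (l := n - 1) (m := n - 1) (by omega) (by omega), e0, map_zero] at h0
      rw [← coeff_x_pow_mul' (l := n - 1) (m := n - 1) (by omega) (by omega), e1, map_zero] at h1
      rw [← coeff_x_pow_mul' (l := n - 1) (m := n - 1) (by omega) (by omega), e2, map_zero] at h2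
      ext α
      fin_cases α
      · exact (mul_eq_zero.1 h0).resolve_left hε
      · exact (mul_eq_zero.1 h1).resolve_left hε
      · exact (mul_eq_zero.1 h2).resolve_left hε
  exists_smul_eq := by
    intro m h
    have h0 := mul_tripleForm_zero hε hr hs m
    have h1 := mul_tripleForm_one hε hr hs m
    have h2 := mul_tripleForm_two hε hr hs m
    rw [h, Pi.zero_apply, mul_zero] at h0 h1 h2
    obtain ⟨q, hq⟩ := exists_eq_x_mul hn (x_pow_mul_eq_zero h0.symm)
    obtain ⟨f, hf⟩ := exists_eq_x_mul hn (x_pow_mul_eq_zero h1.symm)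
    obtain ⟨g, hg⟩ := exists_eq_x_mul hn (x_pow_mul_eq_zero h2.symm)
    refine ⟨ε ^ 3, pow_ne_zero 3 hε, ⟨(eps ε n ^ 3 * q, eps ε n ^ 3 * f, eps ε n ^ 3 * g),
      eps ε n ^ 2 * q - x O n ^ s * (eps ε n * f - x O n ^ r * g),
      eps ε n ^ 2 * f - x O n ^ r * (eps ε n * g), 0, eps ε n ^ 2 * g, 0, 0,
      by ring, by ring, by ring⟩, ?_⟩
    apply Subtype.ext
    rw [← eps_mul_eq_smul (n := n), eps, map_pow]
    refine Prod.ext ?_ (Prod.ext ?_ ?_)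
    · change eps ε n ^ 3 * m.1.1 = x O n * (eps ε n ^ 3 * q)
      rw [hq]; ring
    · change eps ε n ^ 3 * m.1.2.1 = x O n * (eps ε n ^ 3 * f)
      rw [hf]; ring
    · change eps ε n ^ 3 * m.1.2.2 = x O n * (eps ε n ^ 3 * g)
      rw [hg]; ring

/-- The relations between the coefficients of the images of `tripleV`, `tripleU`, `tripleT` under
an endomorphism. -/
theorem tripleCoords_mat_residue [IsLocalRing O] (hu : ¬ IsUnit ε) (hn : r + s + 2 = n) :
    let M := (tripleCoords hε hr hs (by omega) :
      LeadingCoordinates O n (tripleLattice ε n r s) 3).mat ρ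
    let κ := IsLocalRing.residue O
    κ (M 0 0) = κ (M 1 1) ∧ κ (M 1 1) = κ (M 2 2) ∧ κ (M 2 0) = 0 ∧ (s ≤ r → κ (M 1 0) = 0) ∧
      (r < s → κ (M 0 1) = 0) ∧ (r ≤ s → κ (M 2 1) = 0) ∧ (s < r → κ (M 1 2) = 0) := by
  intro M κ
  have hX := eps_smul_map_tripleX ρ
  have hY := eps_smul_map_tripleY ρ
  have hW := eps_smul_map_tripleW ρ
  have hM : ∀ β, M 0 β = tripleForm hε hr hs (ρ (![tripleV ε n r s, tripleU ε n r s,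
      tripleT ε n r s] β)) 0 ∧ M 1 β = tripleForm hε hr hs (ρ (![tripleV ε n r s, tripleU ε n r s,
      tripleT ε n r s] β)) 1 ∧ M 2 β = tripleForm hε hr hs (ρ (![tripleV ε n r s, tripleU ε n r s,
      tripleT ε n r s] β)) 2 := fun β => ⟨rfl, rfl, rfl⟩
  obtain ⟨h00, h10, h20⟩ := hM 0
  obtain ⟨h01, h11, h21⟩ := hM 1
  obtain ⟨h02, h12, h22⟩ := hM 2
  simp only [Matrix.cons_val] at h00 h10 h20 h01 h11 h21 h02 h12 h22
  generalize ρ (tripleX ε n r s) = pX at *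
  generalize ρ (tripleY ε n r s) = pY at *
  generalize ρ (tripleW ε n r s) = pW at *
  generalize ρ (tripleV ε n r s) = pV at *
  generalize ρ (tripleU ε n r s) = pU at *
  generalize ρ (tripleT ε n r s) = pT at *
  -- Every congruence below comes from well-chosen coefficients of the three relations `ε x =
  -- X^(s+1) v`, `ε y = X^(r+1) u - X^r x` and `ε w = X^(s+1) t - X^s y`.
  have hX1 := fun j => congrArg (fun m => coeff n j m.1.1) hX
  have hX2 := fun j => congrArg (fun m => coeff n j m.1.2.1) hX
  have hY1 := fun j => congrArg (fun m => coeff n j m.1.1) hY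
  have hY2 := fun j => congrArg (fun m => coeff n j m.1.2.1) hY
  have hW2 := fun j => congrArg (fun m => coeff n j m.1.2.1) hW
  have hW3 := fun j => congrArg (fun m => coeff n j m.1.2.2) hW
  simp only [Submodule.coe_smul, Submodule.coe_sub, Prod.smul_fst, Prod.smul_snd, Prod.fst_sub,
    Prod.snd_sub, smul_eq_mul, coeff_eps_mul, map_sub] at hX1 hX2 hY1 hY2 hW2 hW3
  have hzero : ∀ {a : O}, ε * a = 0 → a = 0 := fun h => (mul_eq_zero.1 h).resolve_left hε
  have t0 := mul_tripleForm_zero hε hr hs (n := n)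
  have t1 := mul_tripleForm_one hε hr hs (n := n)
  have t2 := mul_tripleForm_two hε hr hs (n := n)
  have d1 := dvd_coeff_sub_tripleForm_one hε hr hs (n := n) (by omega)
  have d2 := dvd_coeff_sub_tripleForm_two hε hr hs (n := n) (by omega)
  -- the coefficients of the images of `tripleX` and `tripleY`
  have x1 : coeff n (s + 1) pX.1.1 = M 0 0 := by
    have h := hX1 (s + 1)
    rw [coeff_x_pow_mul' (by omega) (zero_add _), ← t0, ← h00] at h
    exact mul_left_cancel₀ hε h
  have x2 : coeff n 1 pX.1.1 = 0 := by
    have h := hX1 1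
    rw [coeff_x_pow_mul_of_lt (by omega)] at h
    exact hzero h
  have x3 : coeff n 1 pX.1.2.1 = 0 := by
    have h := hX2 1
    rw [coeff_x_pow_mul_of_lt (by omega)] at h
    exact hzero h
  have y1 : coeff n (r + 1) pY.1.2.1 = M 1 1 := by
    have h := hY2 (r + 1)
    rw [coeff_x_pow_mul' (by omega) (zero_add _), coeff_x_pow_mul' (j := 1) (by omega) (by omega),
      x3, sub_zero, ← t1, ← h11] at h
    exact mul_left_cancel₀ hε h
  have y2 : coeff n (r + 1) pY.1.1 = M 0 1 := by
    have h := hY1 (r + 1)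
    rw [coeff_x_pow_mul' (by omega) (zero_add _), coeff_x_pow_mul' (j := 1) (by omega) (by omega),
      x2, sub_zero, ← t0, ← h01] at h
    exact mul_left_cancel₀ hε h
  have e10 : s ≤ r → κ (M 1 0) = 0 := by
    intro hsr
    apply residue_eq_zero_of_dvd hu
    obtain ⟨c, hc⟩ := d1 pV
    have h := hX1 (2 * s + 1)
    rw [coeff_x_pow_mul' (j := s) (by omega) (by omega)] at h
    rw [h10]
    exact ⟨coeff n (2 * s + 1) pX.1.1 - c, by linear_combination -h - hc⟩
  refine ⟨?_, ?_, ?_, e10, ?_, ?_, ?_⟩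
  -- The top coefficient of the relation for `y` links the first two diagonal entries; that of the
  -- relation for `w` links the last two.
  · apply residue_eq_of_dvd hu
    obtain ⟨c, hc⟩ := d1 pU
    have h := hY1 (n - 1)
    rw [coeff_x_pow_mul' (j := s) (by omega) (by omega),
      coeff_x_pow_mul' (j := s + 1) (by omega) (by omega), x1] at h
    rw [h11]
    exact ⟨c - coeff n (n - 1) pY.1.1, by linear_combination hc + h⟩
  · apply residue_eq_of_dvd hu
    obtain ⟨c, hc⟩ := d2 pT
    have h := hW2 (n - 1)
    rw [coeff_x_pow_mul' (j := r) (by omega) (by omega),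
      coeff_x_pow_mul' (j := r + 1) (by omega) (by omega), y1] at h
    rw [h22]
    exact ⟨c - coeff n (n - 1) pW.1.2.1, by linear_combination hc + h⟩
  · apply residue_eq_zero_of_dvd hu
    obtain ⟨c, hc⟩ := d2 pV
    have h := hX2 (n - 1)
    rw [coeff_x_pow_mul' (j := r) (by omega) (by omega)] at h
    rw [h20]
    exact ⟨coeff n (n - 1) pX.1.2.1 - c, by linear_combination -h - hc⟩
  · intro hrs
    apply residue_eq_zero_of_dvd hu
    rw [← y2]
    rcases (show r + 1 < s ∨ r + 1 = s by omega) with h | h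
    · exact dvd_coeff_fst_of_mem_tripleLattice pY.2 h
    · have h1 := d1 pY
      have h2 : tripleForm hε hr hs pY 1 = 0 := by
        have h3 := hY2 0
        rw [coeff_x_pow_mul_of_lt (by omega), coeff_x_pow_mul_of_lt (by omega), sub_zero] at h3
        exact hzero ((t1 pY).trans (hzero h3))
      rwa [h2, sub_zero, ← congrArg (coeff n) h] at h1
  · intro hrs
    have h := hY2 (2 * r + 1)
    rw [coeff_x_pow_mul' (j := r) (by omega) (by omega),
      coeff_x_pow_mul' (j := r + 1) (by omega) (by omega)] at h
    -- For `r < s` this coefficient vanishes; for `r = s` it is the entry `M 1 0`, already known to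
    -- vanish modulo `ε`.
    have h1 : κ (coeff n (r + 1) pX.1.2.1) = 0 := by
      have h2 := hX2 (r + 1)
      rcases hrs.lt_or_eq with hrs | hrs
      · rw [coeff_x_pow_mul_of_lt (by omega)] at h2
        rw [hzero h2, map_zero]
      · rw [coeff_x_pow_mul' (j := 0) (by omega) (by omega), ← t1, ← h10] at h2
        rw [mul_left_cancel₀ hε h2]
        exact e10 hrs.ge
    have h3 : κ (M 2 1) = κ (coeff n r pU.1.2.1) := by
      rw [h21]
      exact (residue_eq_of_dvd hu (d2 pU)).symm
    rw [h3, ← h1]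
    exact residue_eq_of_dvd hu ⟨_, h.symm⟩
  · intro hsr
    apply residue_eq_zero_of_dvd hu
    have y3 : coeff n 1 pY.1.2.1 = 0 := by
      have h := hY2 1
      rw [coeff_x_pow_mul_of_lt (by omega), coeff_x_pow_mul_of_lt (by omega), sub_zero] at h
      exact hzero h
    have w1 : coeff n (s + 1) pW.1.2.1 = M 1 2 := by
      have h := hW2 (s + 1)
      rw [coeff_x_pow_mul' (by omega) (zero_add _),
        coeff_x_pow_mul' (j := 1) (by omega) (by omega), y3, sub_zero, ← t1, ← h12] at h
      exact mul_left_cancel₀ hε h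
    rw [← w1]
    rcases (show s + 1 < r ∨ s + 1 = r by omega) with h | h
    · exact dvd_coeff_fst_of_mem (snd_mem_pairLattice pW.2) h
    · have h1 := d2 pW
      have h2 : tripleForm hε hr hs pW 2 = 0 := by
        have h3 := hW3 0
        rw [coeff_x_pow_mul_of_lt (by omega), coeff_x_pow_mul_of_lt (by omega), sub_zero] at h3
        exact hzero ((t2 pW).trans (hzero h3))
      rwa [h2, sub_zero, ← congrArg (coeff n) h] at h1

theorem isIndecomposableModule_tripleLattice [IsLocalRing O] (hε : ε ≠ 0) (hu : ¬ IsUnit ε)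
    (hr : 1 ≤ r) (hs : 1 ≤ s) (hn : r + s + 2 = n) :
    IsIndecomposableModule (TruncPoly O n) (tripleLattice ε n r s) := by
  have := isTorsionFree_truncPoly (O := O) (n := n)
  have := isTorsionFree_submodule (O := O) (tripleLattice ε n r s)
  let c : LeadingCoordinates O n (tripleLattice ε n r s) 3 := tripleCoords hε hr hs (by omega)
  have : Nontrivial (tripleLattice ε n r s) := c.nontrivial
  refine c.isIndecomposableModule fun ρ h => ?_
  obtain ⟨h1, h2, h3, h4, h5, h6, h7⟩ := tripleCoords_mat_residue ρ hε hr hs hu hn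
  refine Matrix.idempotent_fin_three h h1 h2 ?_ h3 ?_ ?_
  · rcases le_or_gt s r with h | h
    · exact mul_eq_zero_of_right _ (h4 h)
    · exact mul_eq_zero_of_left (h5 h) _
  · rcases le_or_gt r s with h | h
    · exact mul_eq_zero_of_right _ (h6 h)
    · exact mul_eq_zero_of_left (h7 h) _
  · rcases le_or_gt r s with h | h
    · exact mul_eq_zero_of_right _ (h6 h)
    · exact mul_eq_zero_of_left (h4 h.le) _

end Triple

end TruncPoly

/-! ### Extending linear forms modulo `ε`. -/

section Extension

variable {O : Type*} [CommRing O] [IsDomain O] [IsDiscreteValuationRing O]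

/-- A linear form on `Y'` agrees modulo `ε` with the restriction along `S : Y' → Y` of a linear
form on `Y` if it vanishes modulo `ε` on all elements that `S` maps into `εY`. -/
theorem exists_linearForm_dvd_sub {ε : O} (hε : Irreducible ε) {Y Y' : Type*} [AddCommGroup Y]
    [Module O Y] [Module.Projective O Y] [AddCommGroup Y'] [Module O Y'] (S : Y' →ₗ[O] Y)
    (μ : Y' →ₗ[O] O) (h : ∀ y' y, S y' = ε • y → ε ∣ μ y') :
    ∃ l : Y →ₗ[O] O, ∀ y', ε ∣ l (S y') - μ y' := by
  let I := IsLocalRing.maximalIdeal O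
  have hI : I = Ideal.span {ε} := hε.maximalIdeal_eq
  let _ : Field (O ⧸ I) := Ideal.Quotient.field I
  have hmem : ∀ a : O, I.mkQ a = 0 ↔ ε ∣ a := by
    intro a
    rw [Submodule.mkQ_apply, Submodule.Quotient.mk_eq_zero, hI, Ideal.mem_span_singleton]
  let S' : (Y' ⧸ I • (⊤ : Submodule O Y')) →ₗ[O] (Y ⧸ I • (⊤ : Submodule O Y)) :=
    Submodule.mapQ _ _ S (Submodule.smul_top_le_comap_smul_top I S)
  let μ' : (Y' ⧸ I • (⊤ : Submodule O Y')) →ₗ[O] (O ⧸ I) :=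
    Submodule.liftQ _ (I.mkQ ∘ₗ μ) (by
      rw [Submodule.smul_le]
      intro a ha y _
      rw [hI, Ideal.mem_span_singleton] at ha
      rw [LinearMap.mem_ker, LinearMap.comp_apply, hmem, map_smul, smul_eq_mul]
      exact ha.mul_right _)
  let S'' := LinearMap.extendScalarsOfSurjective (S := O ⧸ I) Ideal.Quotient.mk_surjective S'
  let μ'' := LinearMap.extendScalarsOfSurjective (S := O ⧸ I) Ideal.Quotient.mk_surjective μ'
  -- Over the residue field, a form vanishing on the kernel of a map factors through that map; the
  -- factor then lifts to `O` because `Y` is projective.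
  have hμ : μ'' ∈ LinearMap.range S''.dualMap := by
    rw [LinearMap.range_dualMap_eq_dualAnnihilator_ker, Submodule.mem_dualAnnihilator]
    intro z hz
    obtain ⟨y', rfl⟩ := Submodule.Quotient.mk_surjective _ z
    have hz' : (Submodule.Quotient.mk (S y') : Y ⧸ I • (⊤ : Submodule O Y)) = 0 := hz
    rw [Submodule.Quotient.mk_eq_zero, hI, Submodule.ideal_span_singleton_smul,
      Submodule.mem_smul_pointwise_iff_exists] at hz'
    obtain ⟨y, -, hy⟩ := hz'
    exact (hmem _).2 (h y' y hy.symm)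
  obtain ⟨l', hl'⟩ := hμ
  obtain ⟨l, hl⟩ := Module.projective_lifting_property I.mkQ
    ((l'.restrictScalars O) ∘ₗ (I • (⊤ : Submodule O Y)).mkQ) (Submodule.mkQ_surjective I)
  refine ⟨l, fun y' => ?_⟩
  rw [← hmem, map_sub, sub_eq_zero]
  exact (LinearMap.congr_fun hl (S y')).trans
    (LinearMap.congr_fun hl' (Submodule.Quotient.mk y'))

end Extension

namespace TruncPoly

variable {O : Type u} [CommRing O] {ε : O} {n r s : ℕ}

/-! ### Homomorphisms to `O[X]/(X^n)` and homomorphisms from the lattice of pairs. -/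

section Functionals

variable {Y : Type*} [AddCommGroup Y] [Module O Y] [Module (TruncPoly O n) Y]
  [IsScalarTower O (TruncPoly O n) Y]

/-- Every `O`-linear form on a module over `O[X]/(X^n)` is the top coefficient of a linear map to
`O[X]/(X^n)`. -/
theorem exists_linearMap_coeff (hn : 0 < n) (l : Y →ₗ[O] O) :
    ∃ f : Y →ₗ[TruncPoly O n] TruncPoly O n,
      ∀ j < n, ∀ y, coeff n j (f y) = l (x O n ^ (n - 1 - j) • y) := by
  choose f hf using fun y : Y => exists_coeff_eq n fun j => l (x O n ^ (n - 1 - j) • y)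
  have hadd : ∀ y z, f (y + z) = f y + f z := fun y z => ext_coeff fun j hj => by
    rw [map_add, hf _ j hj, hf _ j hj, hf _ j hj, smul_add, map_add]
  have hx : ∀ y, f (x O n • y) = x O n * f y := fun y => ext_coeff fun j hj => by
    rw [hf _ j hj, smul_smul, ← pow_succ, ← pow_one (x O n), ← pow_mul, one_mul]
    rcases Nat.eq_zero_or_pos j with rfl | hj0
    · rw [show n - 1 - 0 + 1 = n by omega, x_pow_eq_zero n le_rfl, zero_smul, map_zero,
        coeff_x_pow_mul_of_lt Nat.zero_lt_one]
    · rw [coeff_x_pow_mul' (j := j - 1) hj (by omega), hf _ _ (by omega),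
        show n - 1 - (j - 1) = n - 1 - j + 1 by omega]
  have hC : ∀ (a : O) y, f (a • y) = a • f y := fun a y => ext_coeff fun j hj => by
    rw [map_smul, hf _ j hj, hf _ j hj, smul_comm, map_smul]
  refine ⟨{ toFun := f, map_add' := hadd, map_smul' := fun c y => ?_ }, fun j hj y => hf y j hj⟩
  have hc : c ∈ Algebra.adjoin O {AdjoinRoot.root (X ^ n : O[X])} := by
    rw [AdjoinRoot.adjoinRoot_eq_top]; trivial
  rw [RingHom.id_apply, smul_eq_mul]
  induction hc using Algebra.adjoin_induction generalizing y with
  | mem z hz => rw [Set.mem_singleton_iff.1 hz]; exact hx y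
  | algebraMap a => rw [algebraMap_smul, hC, Algebra.smul_def]
  | add a b _ _ ha hb => rw [add_smul, hadd, ha, hb, add_mul]
  | mul a b _ _ ha hb => rw [mul_smul, ha, hb, mul_assoc]

theorem exists_smul_linearMap_eq [Module.IsTorsionFree O Y] [IsDomain O] {M : Type*}
    [AddCommGroup M] [Module (TruncPoly O n) M] {c : O} (hc : c ≠ 0)
    (G : M →ₗ[TruncPoly O n] Y) (h : ∀ m, ∃ y, c • y = G m) :
    ∃ g : M →ₗ[TruncPoly O n] Y, ∀ m, c • g m = G m := by
  choose g hg using h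
  refine ⟨{ toFun := g, map_add' := fun a b => ?_, map_smul' := fun a b => ?_ }, hg⟩
  · apply smul_right_injective Y hc
    simp only [smul_add, hg, map_add]
  · apply smul_right_injective Y hc
    simp only [RingHom.id_apply, hg, map_smul, smul_comm c a]

/-- Homomorphisms from the lattice of pairs are given by their values on generators. -/
theorem exists_hom_pairLattice [IsDomain O] [Module.IsTorsionFree O Y] (hε : ε ≠ 0) {y y' z w : Y}
    (h1 : x O n ^ (r + 1) • y = ε • y') (h2 : x O n ^ s • y' + x O n ^ (s + 1) • z = ε • w) :
    ∃ g : pairLattice ε n r s →ₗ[TruncPoly O n] Y,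
      g (pairV ε n r s) = y ∧ g (pairY ε n r s) = y' := by
  -- `G` is `ε^2 g`: since `(ε^2, 0) = ε v` and `(0, ε^2) = ε u - X^r v`, it is defined on all of `A
  -- ⊕ A`. Here `u` and `w` are meant to go to `-z` and `-w`, so `h1` and `h2` are the two
  -- relations.
  let G : pairLattice ε n r s →ₗ[TruncPoly O n] Y :=
    ((LinearMap.toSpanSingleton (TruncPoly O n) Y (eps ε n • y)).coprod
      (LinearMap.toSpanSingleton (TruncPoly O n) Y (-(eps ε n • z) - x O n ^ r • y))) ∘ₗ
      (pairLattice ε n r s).subtype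
  have hG : ∀ m : pairLattice ε n r s,
      G m = m.1.1 • (eps ε n • y) + m.1.2 • (-(eps ε n • z) - x O n ^ r • y) := fun _ => rfl
  rw [← eps_mul_eq_smul (n := n) ε] at h1 h2
  have hε2 : ε ^ 2 ≠ 0 := pow_ne_zero 2 hε
  have key : ∀ v : Y, ε ^ 2 • v = (eps ε n ^ 2) • v := fun v => by
    rw [← eps_mul_eq_smul (n := n), eps, map_pow]
  obtain ⟨g, hg⟩ := exists_smul_linearMap_eq hε2 G (by
    rintro ⟨⟨f, h⟩, a, b, c, d, hf, hh⟩
    refine ⟨a • y + c • y' - b • z - d • w, ?_⟩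
    change f = _ at hf
    change h = _ at hh
    rw [hG, key]
    change _ = f • _ + h • _
    rw [hf, hh]
    have e1 : x O n ^ (s + 1) • x O n ^ r • y = eps ε n • x O n ^ s • y' := by
      linear_combination (norm := module) (x O n ^ s) • h1
    linear_combination (norm := module) (-eps ε n * c) • h1 + (eps ε n * d) • h2 + d • e1)
  refine ⟨g, ?_, ?_⟩
  · apply smul_right_injective Y hε2
    simp only [hg, hG, key, pairV]
    module
  · apply smul_right_injective Y hε2
    simp only [hg, hG, key, pairY]
    linear_combination (norm := module) (eps ε n) • h1

end Functionals

end TruncPoly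

namespace TruncPoly

variable {O : Type u} [CommRing O] {ε : O} {n r s : ℕ}

/-! ### The explicit exact sequence. -/

section Sequence

theorem dvd_coeff_of_mem_epsX {f : TruncPoly O n} {m j : ℕ} (hf : f ∈ epsX ε n m) (hj : j < m) :
    ε ∣ coeff n j f := by
  obtain ⟨a, b, rfl⟩ := hf
  exact dvd_coeff_of_lt hj a b

theorem pair_mem_of_mem_epsX {f : TruncPoly O n} (hf : f ∈ epsX ε n (r + 1)) :
    (f, 0) ∈ pairLattice ε n r s := by
  obtain ⟨a, b, h⟩ := hf
  exact ⟨a, 0, b, 0, by simp [h], by simp⟩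

theorem snd_mem_epsX {m : TruncPoly O n × TruncPoly O n} (hm : m ∈ pairLattice ε n r s) :
    m.2 ∈ epsX ε n (s + 1) := by
  obtain ⟨a, b, c, d, h1, h2⟩ := hm
  exact ⟨b, d, h2⟩

variable (ε n r s) in
/-- The inclusion `f ↦ (f, 0)`. -/
noncomputable def epsXToPair : epsX ε n (r + 1) →ₗ[TruncPoly O n] pairLattice ε n r s :=
  (LinearMap.inl _ _ _ ∘ₗ (epsX ε n (r + 1)).subtype).codRestrict _
    fun f => pair_mem_of_mem_epsX f.2

theorem triple_mem_of_mem_pairLattice {m : TruncPoly O n × TruncPoly O n}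
    (hm : m ∈ pairLattice ε n s r) : (m.1, m.2, 0) ∈ tripleLattice ε n r s := by
  obtain ⟨a, b, c, d, h1, h2⟩ := hm
  exact ⟨a, b, c, 0, d, 0, h1, by simp [h2], by simp⟩

variable (ε n r s) in
/-- The inclusion `(q, f) ↦ (q, f, 0)`. -/
noncomputable def pairToTriple : pairLattice ε n s r →ₗ[TruncPoly O n] tripleLattice ε n r s :=
  ((LinearMap.fst _ _ _).prod ((LinearMap.snd _ _ _).prod 0) ∘ₗ
    (pairLattice ε n s r).subtype).codRestrict _ fun m => triple_mem_of_mem_pairLattice m.2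

variable (ε n r s) in
/-- The map `(q, f) ↦ f`. -/
noncomputable def pairToEpsX : pairLattice ε n s r →ₗ[TruncPoly O n] epsX ε n (r + 1) :=
  (LinearMap.snd _ _ _ ∘ₗ (pairLattice ε n s r).subtype).codRestrict _ fun m => snd_mem_epsX m.2

variable (ε n r s) in
/-- The map `(q, f) ↦ (-f, (q, f, 0))`. -/
noncomputable def sequenceInl :
    pairLattice ε n s r →ₗ[TruncPoly O n] epsX ε n (r + 1) × tripleLattice ε n r s :=
  (-(pairToEpsX ε n r s)).prod (pairToTriple ε n r s)

variable (ε n r s) in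
/-- The map `(e, (q, f, h)) ↦ (e + f, h)`. -/
noncomputable def sequenceProj :
    epsX ε n (r + 1) × tripleLattice ε n r s →ₗ[TruncPoly O n] pairLattice ε n r s :=
  (epsXToPair ε n r s).coprod (tripleToPair ε n r s)

theorem coe_sequenceProj_fst (m : epsX ε n (r + 1) × tripleLattice ε n r s) :
    (sequenceProj ε n r s m).1.1 = m.1.1 + m.2.1.2.1 := rfl

theorem coe_sequenceProj_snd (m : epsX ε n (r + 1) × tripleLattice ε n r s) :
    (sequenceProj ε n r s m).1.2 = m.2.1.2.2 := zero_add _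

theorem sequenceInl_injective : Function.Injective (sequenceInl ε n r s) := by
  intro a b h
  apply Subtype.ext
  have h1 := congrArg (fun m => (m.2.1.1, m.2.1.2.1)) h
  exact h1

theorem sequenceProj_surjective : Function.Surjective (sequenceProj ε n r s) := by
  rintro ⟨⟨f, h⟩, a, b, c, d, hf, hh⟩
  -- The component `q = X^s a` is the simplest one meeting the gluing condition with `f`.
  refine ⟨(0, ⟨(x O n ^ s * a, f, h), 0, a, 0, b, c, d, by simp, hf, hh⟩), ?_⟩
  apply Subtype.ext
  exact Prod.ext ((coe_sequenceProj_fst _).trans (zero_add _)) (coe_sequenceProj_snd _)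

variable [IsDomain O]

theorem sequence_exact (hε : ε ≠ 0) (hr : 1 ≤ r) (hsn : s < n) :
    Function.Exact (sequenceInl ε n r s) (sequenceProj ε n r s) := by
  rintro ⟨⟨e, he⟩, ⟨⟨q, f, h⟩, hm⟩⟩
  constructor
  · intro h0
    have h1 : e + f = 0 := congrArg (fun m => m.1.1) h0
    have h2 : h = 0 := (zero_add h).symm.trans (congrArg (fun m => m.1.2) h0)
    obtain rfl : e = -f := by linear_combination h1
    subst h2
    obtain ⟨b, hb, hb'⟩ := exists_coeff_zero_of_mem_tripleLattice hr hsn hm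
    have hp : (q, f) ∈ pairLattice ε n s r :=
      mem_pairLattice_of_dvd hsn (fun j hj => dvd_coeff_fst_of_mem_tripleLattice hm hj)
        (fun j hj => dvd_coeff_of_mem_epsX (by simpa using (epsX ε n (r + 1)).neg_mem he) hj)
        hb hb' hε
    exact ⟨⟨(q, f), hp⟩, rfl⟩
  · rintro ⟨⟨⟨q', f'⟩, hp⟩, hm'⟩
    rw [← hm']
    apply Subtype.ext
    exact Prod.ext (neg_add_cancel f') (zero_add 0)

/-- For a section `σ`, the coefficients of `X^(r+1)` in the components `e` and `f` of `σ y` add up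
to `1`. Both are divisible by `ε`: the relation for `w` handles `e`, and the relation for `y`
together with the gluing of `q` and `f` handles `f`. -/
theorem sequence_not_split (hε : ε ≠ 0) (hu : ¬ IsUnit ε) (hr : 1 ≤ r) (hn : r + s + 2 = n) :
    ¬ ∃ σ : pairLattice ε n r s →ₗ[TruncPoly O n] epsX ε n (r + 1) × tripleLattice ε n r s,
      sequenceProj ε n r s ∘ₗ σ = LinearMap.id := by
  rintro ⟨σ, hσ⟩
  apply hu
  have hY := eps_smul_map_pairY σ
  have hW := eps_smul_map_pairW σ
  have h1 : (σ (pairY ε n r s)).1.1 + (σ (pairY ε n r s)).2.1.2.1 = x O n ^ (r + 1) :=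
    congrArg (fun m => m.1.1) (LinearMap.congr_fun hσ (pairY ε n r s))
  replace h1 := congrArg (coeff n (r + 1)) h1
  rw [map_add, coeff_x_pow (by omega)] at h1
  have hY1 := congrArg (fun m => coeff n (n - 1) m.2.1.1) hY
  have hY2 := congrArg (fun m => coeff n (r + 1) m.2.1.2.1) hY
  have hW1 := congrArg (fun m => coeff n (n - 1) m.1.1) hW
  simp only [Prod.smul_fst, Prod.smul_snd, Submodule.coe_smul, smul_eq_mul, coeff_eps_mul,
    Prod.fst_sub, Submodule.coe_sub, map_sub] at hY1 hY2 hW1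
  rw [coeff_x_pow_mul' (j := s) (by omega) (by omega)] at hY1
  rw [coeff_x_pow_mul' (j := 0) (by omega) (by omega)] at hY2
  rw [coeff_x_pow_mul' (j := r) (by omega) (by omega),
    coeff_x_pow_mul' (j := r + 1) (by omega) (by omega)] at hW1
  obtain ⟨b, hb, c, hc⟩ := exists_coeff_zero_of_mem_tripleLattice hr (by omega)
    (σ (pairV ε n r s)).2.2
  rw [hb] at hY2
  have hb' := mul_left_cancel₀ hε hY2
  obtain ⟨d, hd⟩ := dvd_coeff_of_mem_epsX (j := r) (σ (pairU ε n r s)).1.2 (by omega)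
  refine isUnit_of_dvd_one (⟨d - coeff n (n - 1) (σ (pairW ε n r s)).1.1 +
    (coeff n (n - 1) (σ (pairY ε n r s)).2.1.1 - c), ?_⟩)
  linear_combination -h1 + hb' + hd + hW1 - hY1 - hc

end Sequence

/-! ### The lifting criterion. -/

section Lifting

variable [IsDomain O] [IsDiscreteValuationRing O] {Y : Type*} [AddCommGroup Y] [Module O Y]
  [Module (TruncPoly O n) Y] [IsScalarTower O (TruncPoly O n) Y]

/-- A homomorphism to the lattice of pairs lifts along `sequenceProj` if its composites with all
homomorphisms from the lattice of pairs vanish modulo `ε` in the first leading coordinate. -/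
theorem exists_lift_sequenceProj [Module.Projective O Y] [Module.IsTorsionFree O Y]
    (hε : Irreducible ε) (hr : 1 ≤ r) (hn : r + s + 2 = n)
    (α : Y →ₗ[TruncPoly O n] pairLattice ε n r s)
    (h : ∀ g : pairLattice ε n r s →ₗ[TruncPoly O n] Y,
      ε ∣ pairForm hε.ne_zero hr (α (g (pairV ε n r s))) 0) :
    ∃ β : Y →ₗ[TruncPoly O n] epsX ε n (r + 1) × tripleLattice ε n r s,
      sequenceProj ε n r s ∘ₗ β = α := by
  have hε0 := hε.ne_zero
  let mulX : ℕ → Y →ₗ[O] Y := fun m =>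
    (LinearMap.lsmul (TruncPoly O n) Y (x O n ^ m)).restrictScalars O
  have hmulX : ∀ m y, mulX m y = x O n ^ m • y := fun _ _ => rfl
  let a : Y →ₗ[TruncPoly O n] TruncPoly O n :=
    LinearMap.fst _ _ _ ∘ₗ (pairLattice ε n r s).subtype ∘ₗ α
  have ha : ∀ y, a y = (α y).1.1 := fun _ => rfl
  let la : Y →ₗ[O] O := coeff n (n - 1) ∘ₗ a.restrictScalars O
  have hla : ∀ m j, m + j = n - 1 → ∀ y, la (x O n ^ m • y) = coeff n j (a y) := by
    intro m j hmj y
    change coeff n (n - 1) (a (x O n ^ m • y)) = _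
    rw [map_smul, smul_eq_mul, coeff_x_pow_mul' (j := j) (by omega) (by omega)]
  -- the functional giving the component in `epsX`
  let N : Submodule O Y := (LinearMap.range (mulX (r + 1))).comap (LinearMap.lsmul O Y ε)
  have hN : ∀ y', y' ∈ N ↔ ∃ y, x O n ^ (r + 1) • y = ε • y' := fun _ => Iff.rfl
  -- Two conditions modulo `ε` are imposed on `le`: it vanishes on `X^(s+1) Y`, which puts `e` in
  -- `(ε, X^(r+1))`, and it agrees with `la` on `X^s N`, which makes `q` solvable below. An
  -- obstruction `X^s y' + X^(s+1) z = ε w` with `y' ∈ N` is precisely the data of a map `g` from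
  -- the lattice of pairs, and `la (X^s y')` is the coordinate controlled by `h`.
  obtain ⟨le, hle⟩ := exists_linearForm_dvd_sub hε
    ((mulX s ∘ₗ N.subtype).coprod (mulX (s + 1)))
    ((la ∘ₗ mulX s ∘ₗ N.subtype).coprod 0) (by
      rintro ⟨⟨y', hy'⟩, z⟩ w hw
      obtain ⟨y, hy⟩ := (hN y').1 hy'
      simp only [LinearMap.coprod_apply, LinearMap.comp_apply, Submodule.subtype_apply, hmulX,
        LinearMap.zero_apply, add_zero] at hw ⊢
      obtain ⟨g, hg1, hg2⟩ := exists_hom_pairLattice hε0 hy hw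
      rw [hla s (r + 1) (by omega), ← hg2, ha]
      have h1 := coeff_map_pairY_fst hε0 hr hn (α ∘ₗ g)
      rw [LinearMap.comp_apply] at h1
      rw [h1]
      exact h g)
  simp only [Prod.forall, LinearMap.coprod_apply, LinearMap.comp_apply, Submodule.subtype_apply,
    hmulX, LinearMap.zero_apply, add_zero, Subtype.forall] at hle
  obtain ⟨e, he⟩ := exists_linearMap_coeff (n := n) (by omega) le
  have hemem : ∀ y, e y ∈ epsX ε n (r + 1) := by
    intro y
    refine exists_eq_of_dvd_coeff fun j hj => ?_
    have h1 := hle 0 N.zero_mem (x O n ^ (n - 1 - j - (s + 1)) • y)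
    rw [smul_zero, map_zero, zero_add, sub_zero, smul_smul, ← pow_add,
      show s + 1 + (n - 1 - j - (s + 1)) = n - 1 - j by omega] at h1
    rwa [he j (by omega)]
  let e' : Y →ₗ[TruncPoly O n] epsX ε n (r + 1) := e.codRestrict _ hemem
  -- the component in the lattice of pairs
  let b : Y →ₗ[TruncPoly O n] pairLattice ε n r s := α - epsXToPair ε n r s ∘ₗ e'
  let lb : Y →ₗ[O] O := LinearMap.proj 0 ∘ₗ pairForm hε0 hr ∘ₗ b.restrictScalars O
  have hlb : ∀ y, ε * lb y = coeff n 0 (a y - e y) := fun y => mul_pairForm_zero hε0 hr (b y)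
  -- Gluing requires `lq (X^(r+1) y) ≡ lb y` modulo `ε`. If `X^(r+1) y = ε y'`, then `lb y = (la -
  -- le)(X^s y')`, which vanishes modulo `ε` by the choice of `le`.
  obtain ⟨lq, hlq⟩ := exists_linearForm_dvd_sub hε (mulX (r + 1)) lb (by
    intro y y' hy
    have h1 : lb y = la (x O n ^ s • y') - le (x O n ^ s • y') := by
      apply mul_left_cancel₀ hε0
      rw [hlb, map_sub, ← hla (n - 1) 0 (by omega), he 0 (by omega), Nat.sub_zero,
        show n - 1 = s + (r + 1) by omega, pow_add, mul_smul, ← hmulX (r + 1), hy,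
        smul_comm, LinearMap.map_smul la, LinearMap.map_smul le, smul_eq_mul, smul_eq_mul,
        mul_sub]
    have h2 := hle y' ((hN y').2 ⟨y, hy⟩) 0
    rw [smul_zero, add_zero, ← dvd_neg, neg_sub] at h2
    rwa [h1])
  obtain ⟨q, hq⟩ := exists_linearMap_coeff (n := n) (by omega) lq
  have hmem : ∀ y, (q y, (b y).1.1, (b y).1.2) ∈ tripleLattice ε n r s := by
    intro y
    refine mem_tripleLattice_of_dvd hr (by omega) hε0 (b y).2 ?_ (hlb y).symm ?_
    · intro j hj
      have h1 := hlq (x O n ^ (n - 1 - j - (r + 1)) • y)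
      -- The exponent is `s - j > 0`, so the constant coefficient disappears.
      have h2 : lb (x O n ^ (n - 1 - j - (r + 1)) • y) = 0 := by
        apply mul_left_cancel₀ hε0
        rw [hlb, map_smul, map_smul, ← smul_sub, smul_eq_mul,
          coeff_x_pow_mul_of_lt (by omega), mul_zero]
      rw [h2, sub_zero, hmulX, smul_smul, ← pow_add,
        show r + 1 + (n - 1 - j - (r + 1)) = n - 1 - j by omega] at h1
      rwa [hq j (by omega)]
    · have h1 := hlq y
      rw [hmulX] at h1
      rwa [hq s (by omega), show n - 1 - s = r + 1 by omega]
  let c : Y →ₗ[TruncPoly O n] tripleLattice ε n r s :=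
    (q.prod ((pairLattice ε n r s).subtype ∘ₗ b)).codRestrict _ hmem
  refine ⟨e'.prod c, ?_⟩
  ext y
  · change e y + ((α y).1.1 - e y) = (α y).1.1
    ring
  · change 0 + ((α y).1.2 - 0) = (α y).1.2
    ring

end Lifting

/-! ### The sequence is almost split. -/

section AlmostSplit

variable [IsDomain O] [IsDiscreteValuationRing O]
    [IsAdicComplete (IsLocalRing.maximalIdeal O) O]

/-- The almost split sequence ending at a lattice of pairs. -/
theorem isAlmostSplitSequence (hε : Irreducible ε) (hr : 1 ≤ r) (hs : 1 ≤ s)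
    (hn : r + s + 2 = n) :
    IsAlmostSplitSequence O (TruncPoly O n) (sequenceInl ε n r s) (sequenceProj ε n r s) where
  lattice_left := (isALattice_truncPoly.prod isALattice_truncPoly).submodule _
  lattice_middle := (isALattice_truncPoly.submodule _).prod
    ((isALattice_truncPoly.prod (isALattice_truncPoly.prod isALattice_truncPoly)).submodule _)
  lattice_right := (isALattice_truncPoly.prod isALattice_truncPoly).submodule _
  injective := sequenceInl_injective
  exact := sequence_exact hε.ne_zero hr (by omega)
  surjective := sequenceProj_surjective
  not_split := sequence_not_split hε.ne_zero hε.not_isUnit hr hn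
  indecomposable_left :=
    isIndecomposableModule_pairLattice hε.ne_zero hε.not_isUnit hs hr (by omega)
  indecomposable_right :=
    isIndecomposableModule_pairLattice hε.ne_zero hε.not_isUnit hr hs hn
  factor_iff := by
    intro X _ _ _ _ hXl hX f
    have hM := isIndecomposableModule_pairLattice hε.ne_zero hε.not_isUnit hr hs hn
    have hMl : IsALattice O (TruncPoly O n) (pairLattice ε n r s) :=
      (isALattice_truncPoly.prod isALattice_truncPoly).submodule _
    have := hXl.free
    constructor
    · intro hf
      -- Radicality is tested on the lattice of pairs itself: `f g` lies in the Jacobson radical of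
      -- its endomorphism ring.
      refine exists_lift_sequenceProj hε hr hn f fun g => ?_
      have h1 := hf _ hMl hM g LinearMap.id
      rw [LinearMap.id_comp] at h1
      have h2 := not_isUnit_of_mem_jacobson hε.ne_zero hε.not_isUnit hr hs hn _ h1
      rw [LinearMap.comp_apply, ← mem_nonunits_iff, ← IsLocalRing.mem_maximalIdeal,
        hε.maximalIdeal_eq, Ideal.mem_span_singleton] at h2
      exact h2
    · rintro ⟨g, rfl⟩
      by_contra hf
      obtain ⟨t, ht, -⟩ := exists_inverse_of_not_isRadicalHom hX hM hf
      exact sequence_not_split hε.ne_zero hε.not_isUnit hr hn ⟨g ∘ₗ t, ht⟩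

end AlmostSplit

end TruncPoly

theorem mainTheorem5 {O : Type u} [CommRing O] [IsDomain O] [IsDiscreteValuationRing O]
    [IsAdicComplete (IsLocalRing.maximalIdeal O) O] (ε : O) (hε : Irreducible ε)
    (n i : ℕ) (hi : 2 ≤ i) (hin : i + 2 ≤ n) :
    (∃ (F : Type u) (_ : AddCommGroup F) (_ : Module O F) (_ : Module (TruncPoly O n) F)
      (_ : IsScalarTower O (TruncPoly O n) F)
      (ι : TruncPoly.latticeE (n := n) (i := n - i) hε.ne_zero (by omega) (by omega)
        →ₗ[TruncPoly O n] F)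
      (p : F →ₗ[TruncPoly O n]
        TruncPoly.latticeE (n := n) (i := i) hε.ne_zero (by omega) (by omega)),
      IsAlmostSplitSequence O (TruncPoly O n) ι p) ∧
    ∀ (L F : Type u) [AddCommGroup L] [Module O L] [Module (TruncPoly O n) L]
      [IsScalarTower O (TruncPoly O n) L]
      [AddCommGroup F] [Module O F] [Module (TruncPoly O n) F]
      [IsScalarTower O (TruncPoly O n) F]
      (ι : L →ₗ[TruncPoly O n] F)
      (p : F →ₗ[TruncPoly O n]
        TruncPoly.latticeE (n := n) (i := i) hε.ne_zero (by omega) (by omega)),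
      IsAlmostSplitSequence O (TruncPoly O n) ι p →
        Nonempty (L ≃ₗ[TruncPoly O n]
          TruncPoly.latticeE (n := n) (i := n - i) hε.ne_zero (by omega) (by omega)) ∧
        ∃ P Q : Submodule (TruncPoly O n) F, IsCompl P Q ∧
          Nonempty (P ≃ₗ[TruncPoly O n] TruncPoly.heller ε n (n - i)) ∧
          IsIndecomposableModule (TruncPoly O n) Q := by
  obtain ⟨r, rfl⟩ : ∃ r, i = r + 1 := ⟨i - 1, by omega⟩
  obtain ⟨s, hs⟩ : ∃ s, n - (r + 1) = s + 1 := ⟨n - (r + 1) - 1, by omega⟩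
  obtain ⟨e₁⟩ := TruncPoly.nonempty_latticeE_equiv (n := n) (i := n - (r + 1)) (r := s) (s := r)
    hε.ne_zero (by omega) (by omega) hs (by omega)
  obtain ⟨e₂⟩ := TruncPoly.nonempty_latticeE_equiv (n := n) (i := r + 1) (r := r) (s := s)
    hε.ne_zero (by omega) (by omega) rfl (by omega)
  -- Transporting only the end terms leaves the explicit middle term, whose decomposition passes to
  -- any other almost split sequence by uniqueness.
  have h := (TruncPoly.isAlmostSplitSequence (n := n) (r := r) (s := s) hε (by omega) (by omega)
    (by omega)).of_linearEquiv e₁ e₂.symm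
  refine ⟨⟨_, _, _, _, _, _, _, h⟩, ?_⟩
  intro L F _ _ _ _ _ _ _ _ ι p hp
  obtain ⟨hL, ⟨e⟩⟩ := h.unique hp
  refine ⟨hL, ?_⟩
  let inl := LinearMap.inl (TruncPoly O n) (TruncPoly.epsX ε n (r + 1))
    (TruncPoly.tripleLattice ε n r s)
  let inr := LinearMap.inr (TruncPoly O n) (TruncPoly.epsX ε n (r + 1))
    (TruncPoly.tripleLattice ε n r s)
  refine ⟨Submodule.orderIsoMapComap e (LinearMap.range inl),
    Submodule.orderIsoMapComap e (LinearMap.range inr),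
    LinearMap.isCompl_range_inl_inr.map (Submodule.orderIsoMapComap e), ⟨?_⟩, ?_⟩
  · exact (e.submoduleMap _).symm.trans
      ((LinearEquiv.ofInjective inl LinearMap.inl_injective).symm.trans
        (LinearEquiv.ofEq _ _ (TruncPoly.heller_eq_epsX (by omega)).symm))
  · exact (TruncPoly.isIndecomposableModule_tripleLattice hε.ne_zero hε.not_isUnit (by omega)
      (by omega) (by omega)).of_linearEquiv
        ((LinearEquiv.ofInjective inr LinearMap.inr_injective).trans (e.submoduleMap _))
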